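/- Let $E$ be a Lusin topological space (a homeomorph of a Borel subset of a compact metric space), $B(E)^+$ the set of bounded nonnegative Borel functions on $E$, $M(E)$ the space of finite Borel measures on $E$ with the topology of weak convergence, and $M(E)^\circ=M(E)\setminus\{0\}$. Write $\mu(f)=\int f\,d\mu$. Let $\xi$ be a Borel right process in $E$ with (possibly non-conservative) transition semigroup $(P_t)_{t\ge0}$. Let $b$ be a bounded Borel function on $E$, $c\in B(E)^+$, $\eta(x,dy)$ a bounded kernel on $E$, and $H(x,d\nu)$ a $\sigma$-finite kernel from $E$ to $M(E)^\circ$ with $$\sup_{x\in E}\int_{M(E)^\circ}\big[\nu(1)\wedge\nu(1)^2+\nu_x(1)\big]H(x,d\nu)<\infty ,$$ where $\nu_x$ is the restriction of $\nu$ to $E\setminus\{x\}$. For $x\in E$, $f\in B(E)^+$ and $z\ge0$ put $$\phi(x,f)=b(x)f(x)+c(x)f(x)^2-\eta(x,f)+\int_{M(E)^\circ}\big[e^{-\nu(f)}-1+f(x)\nu(\{x\})\big]H(x,d\nu),$$ $$\gamma(x,dy)=\eta(x,dy)+\int_{M(E)^\circ}\nu_x(dy)\,H(x,d\nu),$$ $$\phi_1(x,z)=[b(x)-\gamma(x,1)]z+c(x)z^2+\int_{M(E)^\circ}\big[e^{-z\nu(\{x\})}-1+z\nu(\{x\})\big]H(x,d\nu).$$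 Let $(Q_t)_{t\ge0}$ be the transition semigroup on $M(E)$ of the $(\xi,\phi)$-superprocess, defined by $$\int_{M(E)}e^{-\nu(f)}Q_t(\mu,d\nu)=e^{-\mu(V_tf)},\qquad t\ge 0,\ \mu\in M(E),\ f\in B(E)^+,$$ where $(t,x)\mapsto V_tf(x)$ is the unique nonnegative Borel solution, bounded on $[0,T]\times E$ for every $T\ge 0$, of $$V_tf(x)=P_tf(x)-\int_0^t ds\int_E\phi(y,V_sf)\,P_{t-s}(x,dy),\qquad t\ge0,\ x\in E.$$ Suppose that there is a function $$\phi_*(z)=b_*z+c_*z^2+\int_{(0,\infty)}\big(e^{-zu}-1+zu\big)m_*(du),\qquad z\ge0,$$ with $b_*\in\mathbb R$, $c_*\ge0$ and $(u\wedge u^2)m_*(du)$ a finite measure on $(0,\infty)$, such that $\phi_1(x,z)\ge\phi_*(z)$ for all $x\in E$ and $z\ge0$, and such that $\phi_*$ satisfies Grey's condition: $\phi_*(z)>0$ for all sufficiently large $z$ and $\int^\infty\phi_*(z)^{-1}dz<\infty$. If $\beta_*:=\inf_{x\in E}[b(x)-\gamma(x,1)]>0$, then there is a constant $C\ge0$ such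 that $$\|Q_t(\mu,\cdot)-\delta_0\|_{\mathrm{var}}\le C\,(1+\mu(1))\,e^{-\beta_*t}\qquad\text{for all }t\ge0\text{ and }\mu\in M(E),$$ where $\delta_0$ is the Dirac measure at the zero measure $0\in M(E)$ and $\|Q-Q'\|_{\mathrm{var}}$ is the total mass of the total variation measure $|Q-Q'|$. -/

import Mathlib

open MeasureTheory ProbabilityTheory Filter Topology Set
open scoped NNReal ENNReal

noncomputable section

namespace Superprocess

/-- A Lusin topological space: a homeomorph of a Borel subset of a compact metric space. -/
def IsLusinSpace (E : Type*) [TopologicalSpace E] : Prop :=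
  ∃ (K : Type) (_ : MetricSpace K) (_ : CompactSpace K) (j : E → K),
    IsEmbedding j ∧ MeasurableSet[borel K] (range j)

/-! ### The spatial motion -/

section Motion

variable {E : Type*} [MeasurableSpace E]

/-- A (Borel, possibly sub-Markovian) transition semigroup `(P_t)` on `E`. -/
structure IsTransitionSemigroup (P : ℝ≥0 → Kernel E E) : Prop where
  zero : P 0 = Kernel.id
  chapman_kolmogorov : ∀ s t, P (s + t) = P t ∘ₖ P s
  mass_le_one : ∀ t x, P t x univ ≤ 1

/-- A Borel `α`-excessive function of `(P_t)`: a Borel function `f : E → [0,∞]` with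
`e^{-αt} P_t f ≤ f` for all `t`, and `e^{-αt} P_t f → f` pointwise as `t ↓ 0`. -/
structure IsExcessive (P : ℝ≥0 → Kernel E E) (α : ℝ) (f : E → ℝ≥0∞) : Prop where
  measurable : Measurable f
  supermedian : ∀ (t : ℝ≥0) (x : E),
    ENNReal.ofReal (Real.exp (-α * t)) * ∫⁻ y, f y ∂(P t x) ≤ f x
  tendsto : ∀ x, Tendsto
    (fun t : ℝ≥0 => ENNReal.ofReal (Real.exp (-α * t)) * ∫⁻ y, f y ∂(P t x)) (𝓝[>] 0) (𝓝 (f x))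

/-- A function on `E` extended by `0` to the cemetery. -/
def extendZero (f : E → ℝ≥0∞) : E ⊕ Unit → ℝ≥0∞ := Sum.elim f (fun _ => 0)

/-- A Borel right process `ξ = (Ω, 𝓕, 𝓕_t, ξ_t, 𝐏_x)` in `E`, with its Borel transition semigroup
`(P_t)`. As `(P_t)` need not be conservative, the process takes values in `E ⊕ Unit`, which is `E`
with an isolated cemetery point added. The defining properties are: `𝐏_x`-almost sure start at
`x`, the Markov property, right continuity of the paths, and almost sure right continuity of
`t ↦ f (ξ_t)` for every `α`-excessive `f`, `α > 0`, and every initial law. (For a Borel semigroup,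
Borel excessive functions suffice in the last property; the properties are insensitive to
completing the filtration, which is therefore not imposed.) -/
structure BorelRightProcess (E : Type*) [TopologicalSpace E] [MeasurableSpace E]
    (Ω : Type*) [mΩ : MeasurableSpace Ω] where
  /-- the transition semigroup -/
  P : ℝ≥0 → Kernel E E
  /-- the filtration -/
  filtration : Filtration ℝ≥0 mΩ
  /-- the process -/
  X : ℝ≥0 → Ω → E ⊕ Unit
  /-- the laws `x ↦ 𝐏_x` -/
  law : Kernel E Ω
  semigroup : IsTransitionSemigroup P
  isMarkov_law : IsMarkovKernel law
  adapted : ∀ t, Measurable[filtration t] (X t)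
  start : ∀ x, ∀ᵐ ω ∂(law x), X 0 ω = Sum.inl x
  markov : ∀ (x : E) (s t : ℝ≥0) (A : Set Ω) (B : Set E),
    MeasurableSet[filtration s] A → MeasurableSet B →
      law x (A ∩ X (s + t) ⁻¹' (Sum.inl '' B))
        = ∫⁻ ω in A, extendZero (fun y => P t y B) (X s ω) ∂(law x)
  right_continuous : ∀ ω t, ContinuousWithinAt (fun s => X s ω) (Ici t) t
  excessive_right_continuous : ∀ (α : ℝ), 0 < α → ∀ f : E → ℝ≥0∞, IsExcessive P α f →
    ∀ (μ : Measure E), IsProbabilityMeasure μ → ∀ᵐ ω ∂(μ.bind law), ∀ t,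
      ContinuousWithinAt (fun s => extendZero f (X s ω)) (Ici t) t

end Motion

/-! ### Branching mechanisms -/

section Branching

variable {E : Type*} [MeasurableSpace E]

/-- `M(E)° = M(E) \ {0}`, where `M(E)` is the space of finite measures on `E`. Its `σ`-algebra is
generated by the maps `ν ↦ ν(A)`; on a Lusin space this is the Borel `σ`-algebra of the weak
topology. -/
abbrev NonzeroMeasure (E : Type*) [MeasurableSpace E] := {ν : FiniteMeasure E // ν ≠ 0}

/-- The parameters `(b, c, η, H)` of a branching mechanism on `E`. The kernel `H` is automatically
`σ`-finite by the last condition, since `ν(1) > 0` for all `ν ∈ M(E)°`. -/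
structure BranchingMechanism (E : Type*) [MeasurableSpace E] where
  b : E → ℝ
  c : E → ℝ
  η : Kernel E E
  H : Kernel E (NonzeroMeasure E)
  measurable_b : Measurable b
  bounded_b : ∃ K : ℝ, ∀ x, |b x| ≤ K
  measurable_c : Measurable c
  bounded_c : ∃ K : ℝ, ∀ x, c x ≤ K
  c_nonneg : ∀ x, 0 ≤ c x
  bounded_η : ∃ K : ℝ≥0, ∀ x, η x univ ≤ K
  /-- `sup_x ∫ [ν(1) ∧ ν(1)² + ν_x(1)] H(x,dν) < ∞`, `ν_x` the restriction of `ν` to `E \ {x}` -/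
  bounded_H : ∃ K : ℝ≥0, ∀ x,
    ∫⁻ ν, (min ((ν.1 : Measure E) univ) ((ν.1 : Measure E) univ ^ 2)
      + (ν.1 : Measure E) {x}ᶜ) ∂(H x) ≤ K

namespace BranchingMechanism

variable (φ : BranchingMechanism E)

/-- `φ(x,f) = b(x)f(x) + c(x)f(x)² - η(x,f) + ∫ [e^{-ν(f)} - 1 + f(x)ν({x})] H(x,dν)`. -/
def eval (x : E) (f : E → ℝ) : ℝ :=
  φ.b x * f x + φ.c x * f x ^ 2 - ∫ y, f y ∂(φ.η x)
    + ∫ ν, (Real.exp (-∫ y, f y ∂(ν.1 : Measure E)) - 1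
        + f x * (ν.1 : Measure E).real {x}) ∂(φ.H x)

/-- `γ(x,dy) = η(x,dy) + ∫ ν_x(dy) H(x,dν)`. -/
def γ (x : E) : Measure E :=
  φ.η x + (φ.H x).bind (fun ν => (ν.1 : Measure E).restrict {x}ᶜ)

theorem γ_apply [MeasurableSingletonClass E] (x : E) {A : Set E} (hA : MeasurableSet A) :
    φ.γ x A = φ.η x A + ∫⁻ ν, (ν.1 : Measure E) (A ∩ {x}ᶜ) ∂(φ.H x) := by
  have hm : Measurable (fun ν : NonzeroMeasure E => (ν.1 : Measure E).restrict {x}ᶜ) := by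
    refine Measure.measurable_of_measurable_coe _ fun s hs => ?_
    simp only [Measure.restrict_apply hs]
    exact (Measure.measurable_coe (hs.inter (measurableSet_singleton x).compl)).comp
      (measurable_subtype_coe.comp measurable_subtype_coe)
  rw [γ, Measure.add_apply, Measure.bind_apply hA hm.aemeasurable]
  simp only [Measure.restrict_apply hA]

/-- The local projection
`φ₁(x,z) = [b(x) - γ(x,1)]z + c(x)z² + ∫ [e^{-zν({x})} - 1 + zν({x})] H(x,dν)`. -/
def localProjection (x : E) (z : ℝ) : ℝ :=
  (φ.b x - (φ.γ x).real univ) * z + φ.c x * z ^ 2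
    + ∫ ν, (Real.exp (-(z * (ν.1 : Measure E).real {x})) - 1
        + z * (ν.1 : Measure E).real {x}) ∂(φ.H x)

/-- `β_* = inf_x [b(x) - γ(x,1)]`. -/
def betaStar : ℝ := ⨅ x, (φ.b x - (φ.γ x).real univ)

end BranchingMechanism

/-- The parameters `(b_*, c_*, m_*)` of a spatially independent branching mechanism; only the
restriction of `m` to `(0,∞)` matters. -/
structure CBMechanism where
  b : ℝ
  c : ℝ
  m : Measure ℝ
  c_nonneg : 0 ≤ c
  finite_m : ∫⁻ u in Ioi (0 : ℝ), ENNReal.ofReal (min u (u ^ 2)) ∂m < ∞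

namespace CBMechanism

/-- `φ_*(z) = b_* z + c_* z² + ∫_{(0,∞)} (e^{-zu} - 1 + zu) m_*(du)`. -/
def eval (ψ : CBMechanism) (z : ℝ) : ℝ :=
  ψ.b * z + ψ.c * z ^ 2 + ∫ u in Ioi (0 : ℝ), (Real.exp (-(z * u)) - 1 + z * u) ∂ψ.m

/-- Grey's condition: `φ_*(z) > 0` for sufficiently large `z`, and `∫^∞ φ_*(z)⁻¹ dz < ∞`. -/
def Grey (ψ : CBMechanism) : Prop :=
  ∃ z₀ : ℝ, 0 < z₀ ∧ (∀ z, z₀ ≤ z → 0 < ψ.eval z) ∧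
    IntegrableOn (fun z => (ψ.eval z)⁻¹) (Ioi z₀)

end CBMechanism

end Branching

/-! ### The superprocess -/

section Super

variable {E : Type*} [MeasurableSpace E]

/-- `(t,x) ↦ V_t f(x)` is a locally bounded positive (Borel) solution of
`V_t f(x) = P_t f(x) - ∫_0^t ds ∫ φ(y, V_s f) P_{t-s}(x,dy)`. -/
structure IsCumulant (P : ℝ≥0 → Kernel E E) (φ : BranchingMechanism E) (f : E → ℝ)
    (V : ℝ≥0 → E → ℝ) : Prop where
  measurable : Measurable (fun p : ℝ≥0 × E => V p.1 p.2)
  nonneg : ∀ t x, 0 ≤ V t x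
  locally_bounded : ∀ T : ℝ≥0, ∃ K : ℝ, ∀ t ≤ T, ∀ x, V t x ≤ K
  equation : ∀ (t : ℝ≥0) (x : E),
    V t x = ∫ y, f y ∂(P t x)
      - ∫ s in (0 : ℝ)..t, ∫ y, φ.eval y (V s.toNNReal) ∂(P (t - s.toNNReal) x)

/-- `(Q_t)` is the transition semigroup on `M(E)` of the `(ξ,φ)`-superprocess, where `(P_t)` is the
transition semigroup of `ξ`: for every bounded Borel `f ≥ 0`,
`∫ e^{-ν(f)} Q_t(μ,dν) = e^{-μ(V_t f)}` with `(V_t f)` the locally bounded positive solution of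
the integral evolution equation. -/
def IsSuperprocessSemigroup (P : ℝ≥0 → Kernel E E) (φ : BranchingMechanism E)
    (Q : ℝ≥0 → Kernel (FiniteMeasure E) (FiniteMeasure E)) : Prop :=
  ∀ f : E → ℝ, Measurable f → (∀ x, 0 ≤ f x) → (∃ K : ℝ, ∀ x, f x ≤ K) →
    ∃ V : ℝ≥0 → E → ℝ, IsCumulant P φ f V ∧
      ∀ (t : ℝ≥0) (μ : FiniteMeasure E),
        ∫ ν : FiniteMeasure E, Real.exp (-∫ y, f y ∂(ν : Measure E)) ∂(Q t μ)
          = Real.exp (-∫ y, V t y ∂(μ : Measure E))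

end Super

/-- The total variation distance `‖μ - ν‖_var = |μ - ν|(S)` of finite measures on `S`. -/
def tvDist {S : Type*} [MeasurableSpace S] (μ ν : Measure S) [IsFiniteMeasure μ]
    [IsFiniteMeasure ν] : ℝ :=
  (μ.toSignedMeasure - ν.toSignedMeasure).totalVariation.real univ

end Superprocess

end

noncomputable section

namespace Superprocess

/-! The distance to `δ_0` equals `2 (1 - Q_t(μ,{0}))` (`tvDist_dirac`), and `Q_t(μ,{0})` is the
limit of `exp(-μ(V_t n))` over growing constants `n` (`tendsto_laplace_const`). It therefore
suffices that `V_t f ≤ D e^{-β_* t}` for `t ≥ T`, with `D` and `T` independent of the bounded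
initial value `f` (`exists_uniform_decay`); times `t ≤ T` are absorbed into the constant.

The engine is a linear comparison principle (`IsCumulant.le_exp`). If `0 ≤ f ≤ W`, the non-local
terms lower `φ(x,f)` by at most `W γ(x,1)`, which is exactly the drift subtracted in `φ₁(x,W)`; what
remains is Lipschitz in `f(x)`. So `K f(x) - φ(x,f) ≤ K W - φ₁(x,W)` for large `K`
(`exists_comparison_const`). In the evolution equation with extra killing at rate `K`
(`equation_killed`), any excess over `a e^{-rt}` on `[0,T]` then shrinks by the factor `1 - e^{-KT}
< 1`, and iteration removes it.

The principle is used twice. As `φ_*(z)/z` is nondecreasing, the rate `φ_*(w)/w` is valid above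
level `w`, so a cumulant comes down from `2w` to `w` within time `log 2 · w/φ_*(w)`. Grey's
condition makes these times summable over dyadic levels: a fixed level is reached before a fixed
time from any start (`exists_descent_time`). Afterwards `φ₁(x,z) ≥ β_* z` gives decay at rate `β_*`.
The stages are chained by `IsCumulant.restart`, which follows from the equation by Fubini, without
uniqueness of solutions. -/

/-! ### Joint measurability of the transition semigroup in time and space. -/

theorem IsLusinSpace.metrizableSpace {E : Type*} [TopologicalSpace E] (hE : IsLusinSpace E) :
    TopologicalSpace.MetrizableSpace E := by
  obtain ⟨K, _, _, j, hj, -⟩ := hE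
  exact hj.metrizableSpace

theorem IsLusinSpace.secondCountableTopology {E : Type*} [TopologicalSpace E]
    (hE : IsLusinSpace E) : SecondCountableTopology E := by
  obtain ⟨K, _, _, j, hj, -⟩ := hE
  exact hj.secondCountableTopology

theorem measurableEq_of_secondCountable_t2 {E : Type*} [TopologicalSpace E] [T2Space E]
    [SecondCountableTopology E] [MeasurableSpace E] [BorelSpace E] : MeasurableEq E :=
  ⟨isClosed_diagonal.measurableSet⟩

/-- Dyadic times decreasing to `t`. -/
def dyadicAbove (n : ℕ) (t : ℝ≥0) : ℝ≥0 := (⌊t * 2 ^ n⌋₊ + 1 : ℕ) / 2 ^ n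

theorem lt_dyadicAbove (n : ℕ) (t : ℝ≥0) : t < dyadicAbove n t := by
  rw [dyadicAbove, lt_div_iff₀ (by positivity)]
  exact_mod_cast Nat.lt_floor_add_one (t * 2 ^ n)

theorem tendsto_dyadicAbove (t : ℝ≥0) : Tendsto (fun n => dyadicAbove n t) atTop (𝓝[≥] t) := by
  refine tendsto_nhdsWithin_iff.2 ⟨?_, .of_forall fun n => (lt_dyadicAbove n t).le⟩
  have h1 : Tendsto (fun n : ℕ => t + (1 / 2 : ℝ≥0) ^ n) atTop (𝓝 t) := by
    have : Tendsto (fun n : ℕ => (1 / 2 : ℝ≥0) ^ n) atTop (𝓝 0) := by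
      refine NNReal.tendsto_pow_atTop_nhds_zero_of_lt_one ?_
      rw [← NNReal.coe_lt_coe]; norm_num
    simpa using this.const_add t
  refine tendsto_of_tendsto_of_tendsto_of_le_of_le tendsto_const_nhds h1
    (fun n => (lt_dyadicAbove n t).le) fun n => ?_
  have : (⌊t * 2 ^ n⌋₊ : ℝ≥0) ≤ t * 2 ^ n := Nat.floor_le (by positivity)
  simp only [dyadicAbove]
  rw [div_le_iff₀ (by positivity), add_mul, ← mul_pow]
  push_cast
  simpa using this

/-- A right continuous process with values in a metrizable space is jointly measurable. -/
theorem measurable_uncurry_of_right_continuous {S Ω : Type*} [MeasurableSpace Ω]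
    [TopologicalSpace S] [TopologicalSpace.PseudoMetrizableSpace S] [MeasurableSpace S]
    [BorelSpace S] {X : ℝ≥0 → Ω → S} (hX : ∀ t, Measurable (X t))
    (hc : ∀ ω t, ContinuousWithinAt (fun s => X s ω) (Ici t) t) :
    Measurable (fun p : ℝ≥0 × Ω => X p.1 p.2) := by
  refine measurable_of_tendsto_metrizable (f := fun n (p : ℝ≥0 × Ω) => X (dyadicAbove n p.1) p.2)
    (fun n => ?_) ?_
  -- The discretized time takes countably many values, so joint measurability reduces to that of
  -- each `X t`.
  · have hk : Measurable (fun p : ℝ≥0 × Ω => (⌊p.1 * 2 ^ n⌋₊, p.2)) :=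
      ((Nat.measurable_floor.comp (measurable_fst.mul_const _))).prodMk measurable_snd
    have h2 : Measurable (fun q : ℕ × Ω => X ((q.1 + 1 : ℕ) / 2 ^ n) q.2) :=
      measurable_from_prod_countable_right fun k => (hX ((k + 1 : ℕ) / 2 ^ n) :)
    exact h2.comp hk
  · rw [tendsto_pi_nhds]
    intro p
    exact (hc p.2 p.1).tendsto.comp (tendsto_dyadicAbove p.1)

/-- Path continuity refers to the topology of `E ⊕ Unit`, adaptedness to its sum σ-algebra;
pointwise limits of measurable maps need the two to match. -/
theorem borelSpace_sum {E F : Type*} [TopologicalSpace E] [TopologicalSpace F]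
    [MeasurableSpace E] [BorelSpace E] [MeasurableSpace F] [BorelSpace F] : BorelSpace (E ⊕ F) := by
  constructor
  apply le_antisymm
  · intro s hs
    rw [measurableSet_sum_iff] at hs
    borelize (E ⊕ F)
    have : s = Sum.inl '' (Sum.inl ⁻¹' s) ∪ Sum.inr '' (Sum.inr ⁻¹' s) := by
      ext x; rcases x with x | x <;> simp
    rw [this]
    exact (IsOpenEmbedding.inl.measurableEmbedding.measurableSet_image.2 hs.1).union
      (IsOpenEmbedding.inr.measurableEmbedding.measurableSet_image.2 hs.2)
  · refine MeasurableSpace.generateFrom_le fun s hs => ?_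
    rw [measurableSet_sum_iff]
    have hs' : IsOpen s := hs
    rw [isOpen_sum_iff] at hs'
    exact ⟨hs'.1.measurableSet, hs'.2.measurableSet⟩

namespace BorelRightProcess

variable {E : Type*} [TopologicalSpace E] [MeasurableSpace E]
  {Ω : Type*} [MeasurableSpace Ω] (ξ : BorelRightProcess E Ω)

/-- The Markov property at time `0`, combined with the almost sure start at `x`. -/
theorem semigroup_apply (t : ℝ≥0) (x : E) {B : Set E} (hB : MeasurableSet B) :
    ξ.P t x B = ξ.law x (ξ.X t ⁻¹' (Sum.inl '' B)) := by
  have h := ξ.markov x 0 t univ B MeasurableSet.univ hB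
  have := ξ.isMarkov_law
  rw [univ_inter, zero_add, Measure.restrict_univ] at h
  rw [h, lintegral_congr_ae (g := fun _ => ξ.P t x B)]
  · simp
  · filter_upwards [ξ.start x] with ω hω
    simp [hω, extendZero]

theorem measurable_semigroup [BorelSpace E] [TopologicalSpace.MetrizableSpace E]
    [SecondCountableTopology E] :
    Measurable (fun p : ℝ≥0 × E => ξ.P p.1 p.2) := by
  have := ξ.isMarkov_law
  have : BorelSpace (E ⊕ Unit) := borelSpace_sum
  let := TopologicalSpace.metrizableSpaceMetric E
  let : MetricSpace (E ⊕ Unit) := Metric.metricSpaceSum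
  have hX : Measurable (fun p : ℝ≥0 × Ω => ξ.X p.1 p.2) :=
    measurable_uncurry_of_right_continuous
      (fun t => (ξ.adapted t).mono (ξ.filtration.le t) le_rfl) ξ.right_continuous
  refine Measure.measurable_of_measurable_coe _ fun B hB => ?_
  simp_rw [fun p : ℝ≥0 × E => ξ.semigroup_apply p.1 p.2 hB]
  have hS : MeasurableSet {q : (ℝ≥0 × E) × Ω | ξ.X q.1.1 q.2 ∈ Sum.inl '' B} :=
    (hX.comp (measurable_fst.fst.prodMk measurable_snd)) (hB.inl_image)
  exact Kernel.measurable_kernel_prodMk_left (κ := ξ.law.comap Prod.snd measurable_snd) hS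

end BorelRightProcess

/-! ### The function `e^{-zu} - 1 + zu` -/

theorem exp_neg_sub_one_add_nonneg (a : ℝ) : 0 ≤ Real.exp (-a) - 1 + a := by
  linarith [Real.add_one_le_exp (-a)]

theorem exp_neg_sub_one_add_le_min {z u : ℝ} (hz : 0 ≤ z) (hu : 0 ≤ u) :
    Real.exp (-(z * u)) - 1 + z * u ≤ (z + z ^ 2) * min u (u ^ 2) := by
  have hzu : 0 ≤ z * u := mul_nonneg hz hu
  have h1 : Real.exp (-(z * u)) ≤ 1 := Real.exp_le_one_iff.2 (by linarith)
  have h2 : Real.exp (-(z * u)) - 1 + z * u ≤ (z * u) ^ 2 := by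
    rcases le_total (z * u) 1 with h | h
    · have := Real.abs_exp_sub_one_sub_id_le (x := -(z * u))
        (by rw [abs_neg, abs_of_nonneg hzu]; exact h)
      have := (abs_le.1 this).2
      nlinarith
    · nlinarith
  rcases min_cases u (u ^ 2) with ⟨h, -⟩ | ⟨h, -⟩ <;> rw [h] <;> nlinarith [sq_nonneg z, sq_nonneg u,
    mul_nonneg (sq_nonneg z) hu, mul_nonneg hz (sq_nonneg u)]

theorem exp_neg_sub_one_add_mono {a b : ℝ} (ha : 0 ≤ a) (hab : a ≤ b) :
    Real.exp (-a) - 1 + a ≤ Real.exp (-b) - 1 + b := by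
  have h1 : Real.exp (-a) ≤ 1 := Real.exp_le_one_iff.2 (by linarith)
  have h2 : Real.exp (-b) = Real.exp (-a) * Real.exp (-(b - a)) := by
    rw [← Real.exp_add]; ring_nf
  nlinarith [Real.add_one_le_exp (-(b - a)), Real.exp_pos (-a)]

/-- By convexity in `z` the increment is at most `w - v` times the slope `u (1 - e^{-wu})` at the
right end, and this slope is at most both `u` and `w u²`. -/
theorem exp_neg_sub_one_add_sub_le {v w u : ℝ} (hv : 0 ≤ v) (hvw : v ≤ w) (hu : 0 ≤ u) :
    (Real.exp (-(w * u)) - 1 + w * u) - (Real.exp (-(v * u)) - 1 + v * u)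
      ≤ (w - v) * (1 + w) * min u (u ^ 2) := by
  have hw : 0 ≤ w := hv.trans hvw
  have hd : 0 ≤ w - v := sub_nonneg.2 hvw
  have h1 : Real.exp (-(v * u)) = Real.exp (-(w * u)) * Real.exp ((w - v) * u) := by
    rw [← Real.exp_add]; ring_nf
  have h2 : Real.exp (-(w * u)) * (1 + (w - v) * u) ≤ Real.exp (-(v * u)) := by
    rw [h1]
    gcongr
    linarith [Real.add_one_le_exp ((w - v) * u)]
  have h3 : (Real.exp (-(w * u)) - 1 + w * u) - (Real.exp (-(v * u)) - 1 + v * u)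
      ≤ (w - v) * (u * (1 - Real.exp (-(w * u)))) := by linarith
  refine h3.trans ?_
  rw [mul_assoc]
  refine mul_le_mul_of_nonneg_left ?_ hd
  have h4 : u * (1 - Real.exp (-(w * u))) ≤ u := by nlinarith [Real.exp_pos (-(w * u))]
  have h5 : u * (1 - Real.exp (-(w * u))) ≤ w * u ^ 2 := by
    nlinarith [Real.add_one_le_exp (-(w * u))]
  rcases min_cases u (u ^ 2) with ⟨h, -⟩ | ⟨h, -⟩ <;> rw [h] <;> nlinarith [sq_nonneg u,
    mul_nonneg hw hu]

/-- A convex function vanishing at `0` has nondecreasing slope from the origin; the cross-multiplied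
form avoids division by `y` or `z`. -/
theorem mul_exp_neg_sub_one_add_le {y z u : ℝ} (hy : 0 ≤ y) (hyz : y ≤ z) :
    z * (Real.exp (-(y * u)) - 1 + y * u) ≤ y * (Real.exp (-(z * u)) - 1 + z * u) := by
  rcases hy.eq_or_lt with rfl | hy
  · simp
  have hz : 0 < z := hy.trans_le hyz
  have h := convexOn_exp.2 (mem_univ (-(z * u))) (mem_univ 0)
    (show 0 ≤ y / z by positivity)
    (show 0 ≤ 1 - y / z by rw [sub_nonneg, div_le_one hz]; exact hyz) (by ring)
  simp only [smul_eq_mul, mul_zero, add_zero, Real.exp_zero, mul_one] at h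
  have e : y / z * -(z * u) = -(y * u) := by field_simp
  rw [e] at h
  have h' := mul_le_mul_of_nonneg_left h hz.le
  have e2 : z * (y / z * Real.exp (-(z * u)) + (1 - y / z)) = y * Real.exp (-(z * u)) + (z - y) := by
    field_simp
  rw [e2] at h'
  linarith

/-! ### S-finite kernels -/

/-- Cutting the source space by the integer part of the total mass gives pieces of uniformly bounded
mass. -/
theorem isSFiniteKernel_of_lt_top {α β : Type*} [MeasurableSpace α] [MeasurableSpace β]
    {κ : Kernel α β} (h : ∀ a, κ a univ < ∞) : IsSFiniteKernel κ := by
  classical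
  have hm : Measurable fun a => κ a univ := κ.measurable_coe MeasurableSet.univ
  have hs : ∀ n : ℕ, MeasurableSet {a | ⌊(κ a univ).toReal⌋₊ = n} := fun n =>
    (Nat.measurable_floor.comp hm.ennreal_toReal) (measurableSet_singleton n)
  have e : κ = Kernel.sum fun n => Kernel.piecewise (hs n) κ 0 := by
    ext a B hB
    rw [Kernel.sum_apply' _ _ hB, tsum_eq_single ⌊(κ a univ).toReal⌋₊]
    · simp [Kernel.piecewise_apply]
    · intro n hn
      simp [Kernel.piecewise_apply, hn.symm]
  rw [e]
  have : ∀ n, IsFiniteKernel (Kernel.piecewise (hs n) κ 0) := fun n => by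
    refine ⟨⟨ENNReal.ofReal (n + 1), ENNReal.ofReal_lt_top, fun a => ?_⟩⟩
    rw [Kernel.piecewise_apply]
    split_ifs with ha
    · rw [← ENNReal.ofReal_toReal (h a).ne]
      refine ENNReal.ofReal_le_ofReal ?_
      have ha' : ⌊(κ a univ).toReal⌋₊ = n := ha
      rw [← ha']
      exact (Nat.lt_floor_add_one _).le
    · simp
  exact Kernel.isSFiniteKernel_sum

/-- By Markov's inequality the kernel is uniformly bounded on each set `{h ≥ 1/(n+1)}`; these sets
exhaust the target and are made disjoint. -/
theorem isSFiniteKernel_of_lintegral_le {α β : Type*} [MeasurableSpace α] [MeasurableSpace β]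
    {κ : Kernel α β} {h : β → ℝ≥0∞} (hm : Measurable h) (hpos : ∀ y, 0 < h y) {K : ℝ≥0}
    (hK : ∀ a, ∫⁻ y, h y ∂(κ a) ≤ K) : IsSFiniteKernel κ := by
  let S : ℕ → Set β := fun n => {y | ((n : ℝ≥0∞) + 1)⁻¹ ≤ h y}
  have hS : ∀ n, MeasurableSet (S n) := fun n => measurableSet_le measurable_const hm
  have hSU : ⋃ n, S n = univ := by
    refine eq_univ_of_forall fun y => mem_iUnion.2 ?_
    obtain ⟨n, hn⟩ := ENNReal.exists_inv_nat_lt (hpos y).ne'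
    refine ⟨n, le_trans ?_ hn.le⟩
    exact ENNReal.inv_le_inv.2 le_self_add
  have hD : ∀ n, MeasurableSet (disjointed S n) := fun n => MeasurableSet.disjointed hS n
  have e : κ = Kernel.sum fun n => κ.restrict (hD n) := by
    ext a B hB
    rw [Kernel.sum_apply' _ _ hB]
    simp_rw [Kernel.restrict_apply' _ _ _ hB]
    rw [← measure_iUnion]
    · rw [← inter_iUnion, iUnion_disjointed, hSU, inter_univ]
    · exact fun i j hij => ((disjoint_disjointed S) hij).mono inter_subset_right inter_subset_right
    · exact fun n => hB.inter (hD n)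
  rw [e]
  have : ∀ n, IsFiniteKernel (κ.restrict (hD n)) := fun n => by
    refine ⟨⟨K * (n + 1), ENNReal.mul_lt_top ENNReal.coe_lt_top (by finiteness), fun a => ?_⟩⟩
    rw [Kernel.restrict_apply' _ _ _ MeasurableSet.univ, univ_inter]
    have h1 : ((n : ℝ≥0∞) + 1)⁻¹ * κ a (S n) ≤ K :=
      (mul_meas_ge_le_lintegral hm _).trans (hK a)
    have h2 : κ a (S n) ≤ K * (n + 1) := by
      rw [mul_comm, ← div_eq_mul_inv] at h1
      exact (ENNReal.div_le_iff_le_mul (by simp) (by simp)).1 h1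
    exact (measure_mono (disjointed_subset S n)).trans h2
  exact Kernel.isSFiniteKernel_sum

/-- The tautological kernel from `M(E)` to `E`. -/
def evalKernel (E : Type*) [MeasurableSpace E] : Kernel (FiniteMeasure E) E :=
  ⟨fun ν => (ν : Measure E), measurable_subtype_coe⟩

instance {E : Type*} [MeasurableSpace E] : IsSFiniteKernel (evalKernel E) :=
  isSFiniteKernel_of_lt_top fun ν => measure_lt_top (ν : Measure E) univ

/-! ### Measurability of the branching mechanism. -/

namespace BranchingMechanism

variable {E : Type*} [MeasurableSpace E] (φ : BranchingMechanism E)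

theorem measurable_mass :
    Measurable fun ν : NonzeroMeasure E => (ν.1 : Measure E) univ :=
  (Measure.measurable_coe MeasurableSet.univ).comp
    (measurable_subtype_coe.comp measurable_subtype_coe)

theorem isSFiniteKernel_H : IsSFiniteKernel φ.H := by
  obtain ⟨K, hK⟩ := φ.bounded_H
  refine isSFiniteKernel_of_lintegral_le (K := K)
    (h := fun ν => min ((ν.1 : Measure E) univ) ((ν.1 : Measure E) univ ^ 2))
    (measurable_mass.min (measurable_mass.pow_const 2)) (fun ν => ?_)
    fun x => (lintegral_mono fun ν => le_self_add).trans (hK x)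
  have h0 : 0 < (ν.1 : Measure E) univ := by
    rw [pos_iff_ne_zero, Ne, Measure.measure_univ_eq_zero]
    intro h
    exact ν.2 (Subtype.ext h)
  exact lt_min h0 (ENNReal.pow_pos h0 2)

theorem isFiniteKernel_η : IsFiniteKernel φ.η := by
  obtain ⟨K, hK⟩ := φ.bounded_η
  exact ⟨⟨K, ENNReal.coe_lt_top, hK⟩⟩

variable [MeasurableEq E]

/-- An atom's mass is the mass of a section of the diagonal, which is where a measurable diagonal is
needed. -/
theorem measurable_atom :
    Measurable fun p : E × NonzeroMeasure E => (p.2.1 : Measure E) {p.1} := by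
  have hS : MeasurableSet {q : (E × NonzeroMeasure E) × E | q.2 = q.1.1} :=
    measurableSet_eq_fun measurable_snd measurable_fst.fst
  exact Kernel.measurable_kernel_prodMk_left
    (κ := (evalKernel E).comap (fun p : E × NonzeroMeasure E => p.2.1)
      (measurable_subtype_coe.comp measurable_snd)) hS

/-- `(s, x) ↦ φ(x, V(s, ·))` is measurable when `V` is. -/
theorem measurable_eval {A : Type*} [MeasurableSpace A] {V : A × E → ℝ} (hV : Measurable V) :
    Measurable fun p : A × E => φ.eval p.2 fun y => V (p.1, y) := by
  have := φ.isSFiniteKernel_H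
  have := φ.isFiniteKernel_η
  have h1 : Measurable fun p : A × E => ∫ y, V (p.1, y) ∂(φ.η p.2) :=
    (StronglyMeasurable.integral_kernel_prod_right' (κ := φ.η.comap Prod.snd measurable_snd)
      (f := fun q : (A × E) × E => V (q.1.1, q.2))
      (hV.comp (measurable_fst.fst.prodMk measurable_snd)).stronglyMeasurable).measurable
  have h2 : Measurable fun q : (A × E) × NonzeroMeasure E =>
      ∫ y, V (q.1.1, y) ∂(q.2.1 : Measure E) :=
    (StronglyMeasurable.integral_kernel_prod_right'
      (κ := (evalKernel E).comap (fun q : (A × E) × NonzeroMeasure E => q.2.1)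
        (measurable_subtype_coe.comp measurable_snd))
      (f := fun q : ((A × E) × NonzeroMeasure E) × E => V (q.1.1.1, q.2))
      (hV.comp (measurable_fst.fst.fst.prodMk measurable_snd)).stronglyMeasurable).measurable
  have h3 : Measurable fun q : (A × E) × NonzeroMeasure E =>
      (q.2.1 : Measure E).real {q.1.2} :=
    (measurable_atom.comp (measurable_fst.snd.prodMk measurable_snd)).ennreal_toReal
  have h4 : Measurable fun q : (A × E) × NonzeroMeasure E =>
      Real.exp (-∫ y, V (q.1.1, y) ∂(q.2.1 : Measure E)) - 1
        + V q.1 * (q.2.1 : Measure E).real {q.1.2} :=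
    ((Real.measurable_exp.comp h2.neg).sub_const 1).add ((hV.comp measurable_fst).mul h3)
  have h5 : Measurable fun p : A × E =>
      ∫ ν, (Real.exp (-∫ y, V (p.1, y) ∂(ν.1 : Measure E)) - 1
        + V p * (ν.1 : Measure E).real {p.2}) ∂(φ.H p.2) :=
    (StronglyMeasurable.integral_kernel_prod_right' (κ := φ.H.comap Prod.snd measurable_snd)
      h4.stronglyMeasurable).measurable
  exact ((((φ.measurable_b.comp measurable_snd).mul hV).add
    ((φ.measurable_c.comp measurable_snd).mul (hV.pow_const 2))).sub h1).add h5

end BranchingMechanism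

theorem integrable_of_measurable_of_bounds {E : Type*} [MeasurableSpace E] (ν : Measure E)
    [IsFiniteMeasure ν] {f : E → ℝ} (hf : Measurable f) {W : ℝ} (h0 : ∀ y, 0 ≤ f y)
    (hW : ∀ y, f y ≤ W) : Integrable f ν :=
  .of_bound hf.aestronglyMeasurable W
    (.of_forall fun y => by rw [Real.norm_of_nonneg (h0 y)]; exact hW y)

theorem integral_le_mul_measureReal {E : Type*} [MeasurableSpace E] (ν : Measure E)
    [IsFiniteMeasure ν] {f : E → ℝ} {W : ℝ} (h0 : ∀ y, 0 ≤ f y) (hW : ∀ y, f y ≤ W) :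
    ∫ y, f y ∂ν ≤ W * ν.real univ := by
  refine (integral_mono_of_nonneg (.of_forall h0) (integrable_const W) (.of_forall hW)).trans_eq ?_
  rw [integral_const, smul_eq_mul, mul_comm]

/-! ### Estimates comparing `φ` with its local projection. -/

namespace BranchingMechanism

variable {E : Type*} [MeasurableSpace E] (φ : BranchingMechanism E)

/-- A common bound for the two moments of the jump kernel in `bounded_H`. -/
theorem exists_moment_bound [MeasurableSingletonClass E] : ∃ K : ℝ, 0 ≤ K ∧ ∀ x,
    (Integrable (fun ν => min ((ν.1 : Measure E).real univ) ((ν.1 : Measure E).real univ ^ 2))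
        (φ.H x) ∧
      ∫ ν, min ((ν.1 : Measure E).real univ) ((ν.1 : Measure E).real univ ^ 2) ∂(φ.H x) ≤ K) ∧
    (Integrable (fun ν => (ν.1 : Measure E).real {x}ᶜ) (φ.H x) ∧
      ∫ ν, (ν.1 : Measure E).real {x}ᶜ ∂(φ.H x) ≤ K) := by
  obtain ⟨K, hK⟩ := φ.bounded_H
  have key : ∀ (x : E) (h : NonzeroMeasure E → ℝ≥0∞), Measurable h → (∀ ν, h ν < ∞) →
      ∫⁻ ν, h ν ∂(φ.H x) ≤ K →
      Integrable (fun ν => (h ν).toReal) (φ.H x) ∧ ∫ ν, (h ν).toReal ∂(φ.H x) ≤ K := by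
    intro x h hm ht hK
    refine ⟨integrable_toReal_of_lintegral_ne_top hm.aemeasurable
      (hK.trans_lt ENNReal.coe_lt_top).ne, ?_⟩
    rw [integral_toReal hm.aemeasurable (.of_forall ht)]
    exact ENNReal.toReal_le_coe_of_le_coe hK
  refine ⟨K, K.2, fun x => ⟨?_, ?_⟩⟩
  · have := key x (fun ν => min ((ν.1 : Measure E) univ) ((ν.1 : Measure E) univ ^ 2))
      (measurable_mass.min (measurable_mass.pow_const 2))
      (fun ν => (min_le_left _ _).trans_lt (measure_lt_top _ _))
      ((lintegral_mono fun ν => le_self_add).trans (hK x))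
    simp_rw [fun ν : NonzeroMeasure E => ENNReal.toReal_min (measure_ne_top (ν.1 : Measure E) univ)
      (ENNReal.pow_ne_top (n := 2) (measure_ne_top (ν.1 : Measure E) univ)),
      ENNReal.toReal_pow] at this
    exact this
  · exact key x (fun ν => (ν.1 : Measure E) {x}ᶜ)
      ((Measure.measurable_coe (measurableSet_singleton x).compl).comp
        (measurable_subtype_coe.comp measurable_subtype_coe))
      (fun ν => measure_lt_top _ _) ((lintegral_mono fun ν => le_add_self).trans (hK x))

theorem γ_real_univ [MeasurableSingletonClass E] (x : E) :
    (φ.γ x).real univ = (φ.η x).real univ + ∫ ν, (ν.1 : Measure E).real {x}ᶜ ∂(φ.H x) := by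
  have := φ.isFiniteKernel_η
  obtain ⟨K, hK⟩ := φ.bounded_H
  have hm : Measurable fun ν : NonzeroMeasure E => (ν.1 : Measure E) {x}ᶜ :=
    (Measure.measurable_coe (measurableSet_singleton x).compl).comp
        (measurable_subtype_coe.comp measurable_subtype_coe)
  have hfin : ∫⁻ ν, (ν.1 : Measure E) {x}ᶜ ∂(φ.H x) ≠ ∞ :=
    (((lintegral_mono fun ν => le_add_self).trans (hK x)).trans_lt ENNReal.coe_lt_top).ne
  rw [measureReal_def, φ.γ_apply x MeasurableSet.univ]
  simp_rw [univ_inter]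
  rw [ENNReal.toReal_add (measure_ne_top _ _) hfin, ← integral_toReal hm.aemeasurable
    (.of_forall fun ν => measure_lt_top _ _)]
  rfl

theorem exists_γ_bound [MeasurableSingletonClass E] :
    ∃ K : ℝ, 0 ≤ K ∧ ∀ x, (φ.γ x).real univ ≤ K := by
  obtain ⟨K, hK0, hK⟩ := φ.exists_moment_bound
  obtain ⟨L, hL⟩ := φ.bounded_η
  refine ⟨L + K, by positivity, fun x => ?_⟩
  rw [γ_real_univ]
  exact add_le_add (ENNReal.toReal_le_coe_of_le_coe (hL x)) (hK x).2.2

theorem integral_local_nonneg (x : E) (z : ℝ) :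
    0 ≤ ∫ ν, (Real.exp (-(z * (ν.1 : Measure E).real {x})) - 1
      + z * (ν.1 : Measure E).real {x}) ∂(φ.H x) :=
  integral_nonneg fun _ => exp_neg_sub_one_add_nonneg _

variable [MeasurableEq E]

theorem measurable_atom_left (x : E) :
    Measurable fun ν : NonzeroMeasure E => (ν.1 : Measure E).real {x} :=
  ((Measure.measurable_coe (measurableSet_singleton x)).comp
        (measurable_subtype_coe.comp measurable_subtype_coe)).ennreal_toReal

/-- The integrand of the jump part of the local projection is integrable. -/
theorem integrable_local (x : E) {z : ℝ} (hz : 0 ≤ z) :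
    Integrable (fun ν => Real.exp (-(z * (ν.1 : Measure E).real {x})) - 1
      + z * (ν.1 : Measure E).real {x}) (φ.H x) := by
  obtain ⟨K, -, hK⟩ := φ.exists_moment_bound
  have hm : Measurable fun ν : NonzeroMeasure E => z * (ν.1 : Measure E).real {x} :=
    (measurable_atom_left x).const_mul z
  refine (((hK x).1.1).const_mul (z + z ^ 2)).mono'
    (((Real.measurable_exp.comp hm.neg).sub_const 1).add hm).aestronglyMeasurable
    (.of_forall fun ν => ?_)
  rw [Real.norm_of_nonneg (exp_neg_sub_one_add_nonneg _)]
  refine (exp_neg_sub_one_add_mono (by positivity) (mul_le_mul_of_nonneg_left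
    (measureReal_mono (subset_univ {x})) hz)).trans
    (exp_neg_sub_one_add_le_min hz measureReal_nonneg)

/-- Local Lipschitz bound for the jump part: the pointwise estimate is integrated after enlarging
`ν({x})` to `ν(1)`, whose truncated moment is controlled. -/
theorem integral_local_sub_le {K : ℝ} (x : E)
    (hi : Integrable (fun ν => min ((ν.1 : Measure E).real univ) ((ν.1 : Measure E).real univ ^ 2))
        (φ.H x))
    (hK : ∫ ν, min ((ν.1 : Measure E).real univ) ((ν.1 : Measure E).real univ ^ 2) ∂(φ.H x) ≤ K)
    {v w : ℝ} (hv : 0 ≤ v) (hvw : v ≤ w) :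
    ∫ ν, (Real.exp (-(w * (ν.1 : Measure E).real {x})) - 1
        + w * (ν.1 : Measure E).real {x}) ∂(φ.H x)
      - ∫ ν, (Real.exp (-(v * (ν.1 : Measure E).real {x})) - 1
        + v * (ν.1 : Measure E).real {x}) ∂(φ.H x) ≤ (w - v) * (1 + w) * K := by
  have hw : 0 ≤ w := hv.trans hvw
  have hd : 0 ≤ w - v := sub_nonneg.2 hvw
  rw [← integral_sub (φ.integrable_local x hw) (φ.integrable_local x hv)]
  refine le_trans (b := ∫ ν, (w - v) * (1 + w) *
    min ((ν.1 : Measure E).real univ) ((ν.1 : Measure E).real univ ^ 2) ∂(φ.H x)) ?_ ?_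
  · refine integral_mono ((φ.integrable_local x hw).sub (φ.integrable_local x hv))
      (hi.const_mul _) fun ν => ?_
    refine (exp_neg_sub_one_add_sub_le hv hvw measureReal_nonneg).trans ?_
    refine mul_le_mul_of_nonneg_left ?_ (by positivity)
    have : (ν.1 : Measure E).real {x} ≤ (ν.1 : Measure E).real univ :=
      measureReal_mono (subset_univ {x})
    exact min_le_min this (by gcongr)
  · rw [integral_const_mul]
    exact mul_le_mul_of_nonneg_left hK (by positivity)

/-- Splitting off the mass outside `x` in the integrand of the jump part of `φ`. -/
theorem integrand_bounds (x : E) {f : E → ℝ} (hf : Measurable f) {W : ℝ} (h0 : ∀ y, 0 ≤ f y)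
    (hW : ∀ y, f y ≤ W) (ν : Measure E) [IsFiniteMeasure ν] :
    (Real.exp (-(f x * ν.real {x})) - 1 + f x * ν.real {x}) - W * ν.real {x}ᶜ
        ≤ Real.exp (-∫ y, f y ∂ν) - 1 + f x * ν.real {x} ∧
      Real.exp (-∫ y, f y ∂ν) - 1 + f x * ν.real {x}
        ≤ Real.exp (-(f x * ν.real {x})) - 1 + f x * ν.real {x} := by
  have hi : Integrable f ν := integrable_of_measurable_of_bounds ν hf h0 hW
  have hsplit : ∫ y, f y ∂ν = f x * ν.real {x} + ∫ y in {x}ᶜ, f y ∂ν := by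
    rw [← integral_add_compl (measurableSet_singleton x) hi, integral_singleton, smul_eq_mul,
      mul_comm]
  have h1 : 0 ≤ ∫ y in {x}ᶜ, f y ∂ν := integral_nonneg h0
  have h2 : ∫ y in {x}ᶜ, f y ∂ν ≤ W * ν.real {x}ᶜ := by
    refine (integral_le_mul_measureReal _ h0 hW).trans_eq ?_
    rw [measureReal_restrict_apply_univ]
  have ha : 0 ≤ f x * ν.real {x} := mul_nonneg (h0 x) measureReal_nonneg
  have e1 : Real.exp (-(f x * ν.real {x})) ≤ 1 := Real.exp_le_one_iff.2 (by linarith)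
  rw [hsplit, neg_add, Real.exp_add]
  -- With `0 < a ≤ 1`, the error `a (e^{-r} - 1)` of dropping the mass off `x` lies in `[-r, 0]`.
  set a := Real.exp (-(f x * ν.real {x}))
  have ea : 0 < a := Real.exp_pos _
  set r := ∫ y in {x}ᶜ, f y ∂ν
  have e2 : Real.exp (-r) ≤ 1 := Real.exp_le_one_iff.2 (by linarith)
  have e3 := Real.add_one_le_exp (-r)
  constructor <;> nlinarith

theorem integrable_eval (x : E) {f : E → ℝ} (hf : Measurable f) {W : ℝ} (h0 : ∀ y, 0 ≤ f y)
    (hW : ∀ y, f y ≤ W) : Integrable (fun ν => Real.exp (-∫ y, f y ∂(ν.1 : Measure E)) - 1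
      + f x * (ν.1 : Measure E).real {x}) (φ.H x) := by
  obtain ⟨K, -, hK⟩ := φ.exists_moment_bound
  have hm1 : Measurable fun ν : NonzeroMeasure E => ∫ y, f y ∂(ν.1 : Measure E) :=
    (StronglyMeasurable.integral_kernel (κ := (evalKernel E).comap
      (fun ν : NonzeroMeasure E => ν.1) measurable_subtype_coe) hf.stronglyMeasurable).measurable
  have hm : Measurable fun ν : NonzeroMeasure E => Real.exp (-∫ y, f y ∂(ν.1 : Measure E)) - 1
      + f x * (ν.1 : Measure E).real {x} :=
    ((Real.measurable_exp.comp hm1.neg).sub_const 1).add ((measurable_atom_left x).const_mul _)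
  refine ((φ.integrable_local x (h0 x)).add ((hK x).2.1.const_mul W)).mono'
    hm.aestronglyMeasurable (.of_forall fun ν => ?_)
  have hb := integrand_bounds x hf h0 hW (ν.1 : Measure E)
  have := exp_neg_sub_one_add_nonneg (f x * (ν.1 : Measure E).real {x})
  have : 0 ≤ W * (ν.1 : Measure E).real {x}ᶜ :=
    mul_nonneg ((h0 x).trans (hW x)) measureReal_nonneg
  rw [Real.norm_eq_abs, abs_le]
  simp only [Pi.add_apply]
  constructor <;> linarith [hb.1, hb.2]

/-- Both non-local effects, `η` and the jump mass off `x`, only lower `φ`, and jointly by at most `W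
γ(x,1)`. Apart from this error the bounds involve `f` only through `f x`. -/
theorem eval_bounds (x : E) {f : E → ℝ} (hf : Measurable f) {W : ℝ} (h0 : ∀ y, 0 ≤ f y)
    (hW : ∀ y, f y ≤ W) :
    φ.b x * f x + φ.c x * f x ^ 2 - W * (φ.γ x).real univ
        + ∫ ν, (Real.exp (-(f x * (ν.1 : Measure E).real {x})) - 1
          + f x * (ν.1 : Measure E).real {x}) ∂(φ.H x) ≤ φ.eval x f ∧
      φ.eval x f ≤ φ.b x * f x + φ.c x * f x ^ 2
        + ∫ ν, (Real.exp (-(f x * (ν.1 : Measure E).real {x})) - 1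
          + f x * (ν.1 : Measure E).real {x}) ∂(φ.H x) := by
  have := φ.isFiniteKernel_η
  obtain ⟨K, -, hK⟩ := φ.exists_moment_bound
  have hη0 : 0 ≤ ∫ y, f y ∂(φ.η x) := integral_nonneg h0
  have hη : ∫ y, f y ∂(φ.η x) ≤ W * (φ.η x).real univ := integral_le_mul_measureReal _ h0 hW
  have hl : ∫ ν, ((Real.exp (-(f x * (ν.1 : Measure E).real {x})) - 1
        + f x * (ν.1 : Measure E).real {x}) - W * (ν.1 : Measure E).real {x}ᶜ) ∂(φ.H x) ≤
      ∫ ν, (Real.exp (-∫ y, f y ∂(ν.1 : Measure E)) - 1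
        + f x * (ν.1 : Measure E).real {x}) ∂(φ.H x) :=
    integral_mono ((φ.integrable_local x (h0 x)).sub ((hK x).2.1.const_mul W))
      (φ.integrable_eval x hf h0 hW) fun ν => (integrand_bounds x hf h0 hW _).1
  rw [integral_sub (φ.integrable_local x (h0 x)) ((hK x).2.1.const_mul W),
    integral_const_mul] at hl
  have hu : ∫ ν, (Real.exp (-∫ y, f y ∂(ν.1 : Measure E)) - 1
        + f x * (ν.1 : Measure E).real {x}) ∂(φ.H x) ≤
      ∫ ν, (Real.exp (-(f x * (ν.1 : Measure E).real {x})) - 1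
        + f x * (ν.1 : Measure E).real {x}) ∂(φ.H x) :=
    integral_mono (φ.integrable_eval x hf h0 hW) (φ.integrable_local x (h0 x))
      fun ν => (integrand_bounds x hf h0 hW _).2
  rw [γ_real_univ, eval]
  constructor <;> linarith

/-- `φ(x, f)` is bounded over `x` and `0 ≤ f ≤ W`. -/
theorem exists_eval_bound (W : ℝ) : ∃ C : ℝ, ∀ (x : E) (f : E → ℝ), Measurable f →
    (∀ y, 0 ≤ f y) → (∀ y, f y ≤ W) → |φ.eval x f| ≤ C := by
  obtain ⟨K, hK0, hK⟩ := φ.exists_moment_bound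
  obtain ⟨G, hG0, hG⟩ := φ.exists_γ_bound
  obtain ⟨B, hB⟩ := φ.bounded_b
  obtain ⟨D, hD⟩ := φ.bounded_c
  refine ⟨B * W + D * W ^ 2 + W * G + W * (1 + W) * K, fun x f hf h0 hW => ?_⟩
  have hv := h0 x
  have hvW := hW x
  have hW0 : 0 ≤ W := hv.trans hvW
  obtain ⟨hl, hu⟩ := φ.eval_bounds x hf h0 hW
  have hJ := φ.integral_local_nonneg x (f x)
  have hJ' := φ.integral_local_sub_le x (hK x).1.1 (hK x).1.2 le_rfl hv
  simp only [zero_mul, neg_zero, Real.exp_zero, sub_self, add_zero, integral_zero, sub_zero] at hJ'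
  have hJ'' : f x * (1 + f x) * K ≤ W * (1 + W) * K := by gcongr
  have hb1 : |φ.b x * f x| ≤ B * W := by
    rw [abs_mul, abs_of_nonneg hv]
    exact mul_le_mul (hB x) hvW hv ((abs_nonneg _).trans (hB x))
  have hc0 : 0 ≤ φ.c x * f x ^ 2 := mul_nonneg (φ.c_nonneg x) (sq_nonneg _)
  have hc1 : φ.c x * f x ^ 2 ≤ D * W ^ 2 :=
    mul_le_mul (hD x) (by gcongr) (sq_nonneg _) ((φ.c_nonneg x).trans (hD x))
  have hg : W * (φ.γ x).real univ ≤ W * G := mul_le_mul_of_nonneg_left (hG x) hW0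
  have hg0 : 0 ≤ W * G := by positivity
  have hk0 : 0 ≤ W * (1 + W) * K := by positivity
  obtain ⟨hb2, hb3⟩ := abs_le.1 hb1
  rw [abs_le]
  constructor <;> linarith

/-- For large `K`, the map `f ↦ K f(x) - φ(x, f)` on `0 ≤ f ≤ W` is dominated by its value at the
constant `W`, with `φ` replaced by its local projection. -/
theorem exists_comparison_const (M : ℝ) : ∃ K₀ : ℝ, ∀ K, K₀ ≤ K → ∀ (x : E) (f : E → ℝ) (W : ℝ),
    Measurable f → (∀ y, 0 ≤ f y) → (∀ y, f y ≤ W) → W ≤ M →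
      K * f x - φ.eval x f ≤ K * W - φ.localProjection x W := by
  obtain ⟨L, hL0, hL⟩ := φ.exists_moment_bound
  obtain ⟨B, hB⟩ := φ.bounded_b
  obtain ⟨D, hD⟩ := φ.bounded_c
  -- A Lipschitz constant on `[0, M]` of the local part, with contributions from the linear,
  -- quadratic and jump terms. The terms `W γ(x,1)` cancel exactly.
  refine ⟨B + 2 * D * M + (1 + M) * L, fun K hK x f W hf h0 hW hWM => ?_⟩
  have hv := h0 x
  have hvW := hW x
  have hd : 0 ≤ W - f x := sub_nonneg.2 hvW
  have hl := (φ.eval_bounds x hf h0 hW).1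
  have hJ := φ.integral_local_sub_le x (hL x).1.1 (hL x).1.2 hv hvW
  have hJ' : (W - f x) * (1 + W) * L ≤ (W - f x) * ((1 + M) * L) := by
    rw [mul_assoc]; gcongr
  have hb : φ.b x ≤ B := (abs_le.1 (hB x)).2
  have hc : φ.c x * (W + f x) ≤ 2 * D * M := by
    have hD0 := (φ.c_nonneg x).trans (hD x)
    have : φ.c x * (W + f x) ≤ D * (2 * M) :=
      mul_le_mul (hD x) (by linarith) (by linarith) hD0
    linarith
  have hm : 0 ≤ (W - f x) * (K - φ.b x - φ.c x * (W + f x) - (1 + M) * L) :=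
    mul_nonneg hd (by linarith)
  rw [localProjection]
  nlinarith

theorem betaStar_le (x : E) : φ.betaStar ≤ φ.b x - (φ.γ x).real univ := by
  obtain ⟨G, hG0, hG⟩ := φ.exists_γ_bound
  obtain ⟨B, hB⟩ := φ.bounded_b
  refine ciInf_le ⟨-B - G, ?_⟩ x
  rintro _ ⟨y, rfl⟩
  have h1 := (abs_le.1 (hB y)).1
  have h2 := hG y
  dsimp only
  linarith

theorem betaStar_mul_le_localProjection (x : E) {z : ℝ} (hz : 0 ≤ z) :
    φ.betaStar * z ≤ φ.localProjection x z := by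
  have h1 := mul_le_mul_of_nonneg_right (φ.betaStar_le x) hz
  have h2 := φ.integral_local_nonneg x z
  have h3 : 0 ≤ φ.c x * z ^ 2 := mul_nonneg (φ.c_nonneg x) (sq_nonneg _)
  rw [localProjection]
  linarith

end BranchingMechanism

/-- Variation of constants for an absolutely continuous function `p - ∫₀ h`. -/
theorem integral_exp_mul_sub_primitive {h : ℝ → ℝ} {t : ℝ} (hh : IntervalIntegrable h volume 0 t)
    (K p : ℝ) :
    ∫ s in (0 : ℝ)..t, Real.exp (-(K * (t - s))) * (K * (p - ∫ r in (0 : ℝ)..s, h r) - h s)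
      = p - (∫ r in (0 : ℝ)..t, h r) - Real.exp (-(K * t)) * p := by
  have hg : ∀ s : ℝ, HasDerivAt (fun s => Real.exp (-(K * (t - s))))
      (Real.exp (-(K * (t - s))) * K) s := fun s => by
    have := (((hasDerivAt_id s).const_sub t).const_mul K).neg.exp
    simpa using this
  -- As `h` is merely integrable, the product rule holds only almost everywhere; absolute continuity
  -- still permits integrating it.
  have hF : AbsolutelyContinuousOnInterval (fun s => ∫ r in (0 : ℝ)..s, h r) 0 t :=
    hh.absolutelyContinuousOnInterval_intervalIntegral (by simp)
  have hgA : AbsolutelyContinuousOnInterval (fun s => Real.exp (-(K * (t - s)))) 0 t :=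
    (ContDiff.contDiffOn (by fun_prop)).absolutelyContinuousOnInterval
  have hcA : AbsolutelyContinuousOnInterval (fun _ => p) 0 t :=
    (ContDiff.contDiffOn (by fun_prop)).absolutelyContinuousOnInterval
  have := (hgA.mul (hcA.sub hF)).integral_deriv_eq_sub
  simp only [Pi.mul_apply, Pi.sub_apply, sub_self, mul_zero, neg_zero, Real.exp_zero, one_mul,
    sub_zero, intervalIntegral.integral_same] at this
  rw [← this]
  refine intervalIntegral.integral_congr_ae ?_
  filter_upwards [hh.ae_hasDerivAt_integral] with s hs hst
  have h1 := (hg s).mul ((hasDerivAt_const s p).sub (hs (uIoc_subset_uIcc hst) 0 (by simp)))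
  rw [h1.deriv]
  simp only [Pi.sub_apply]
  ring

/-! ### Integration against a sub-Markov semigroup. -/

section Semigroup

variable {E : Type*} [MeasurableSpace E] {P : ℝ≥0 → Kernel E E}

theorem IsTransitionSemigroup.isFiniteMeasure (hP : IsTransitionSemigroup P) (t : ℝ≥0) (x : E) :
    IsFiniteMeasure (P t x) :=
  ⟨(hP.mass_le_one t x).trans_lt ENNReal.one_lt_top⟩

theorem IsTransitionSemigroup.integral_le (hP : IsTransitionSemigroup P) (t : ℝ≥0) (x : E)
    {f : E → ℝ} {W : ℝ} (hW0 : 0 ≤ W) (hW : ∀ y, f y ≤ W) (hf : Integrable f (P t x)) :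
    ∫ y, f y ∂(P t x) ≤ W := by
  have := hP.isFiniteMeasure t x
  have h1 : (P t x).real univ ≤ 1 := ENNReal.toReal_mono ENNReal.one_ne_top (hP.mass_le_one t x)
  refine (integral_mono hf (integrable_const W) hW).trans ?_
  rw [integral_const, smul_eq_mul]
  nlinarith

theorem IsTransitionSemigroup.abs_integral_le (hP : IsTransitionSemigroup P) (t : ℝ≥0) (x : E)
    {f : E → ℝ} {W : ℝ} (hW0 : 0 ≤ W) (hW : ∀ y, |f y| ≤ W) :
    |∫ y, f y ∂(P t x)| ≤ W := by
  have := hP.isFiniteMeasure t x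
  have h1 : (P t x).real univ ≤ 1 := ENNReal.toReal_mono ENNReal.one_ne_top (hP.mass_le_one t x)
  have h2 : ∀ᵐ y ∂(P t x), ‖f y‖ ≤ W := .of_forall hW
  refine (norm_integral_le_of_norm_le_const h2).trans ?_
  nlinarith

theorem IsTransitionSemigroup.integral_add (hP : IsTransitionSemigroup P) (s t : ℝ≥0) (x : E)
    {f : E → ℝ} (hf : Measurable f) {W : ℝ} (hW : ∀ y, |f y| ≤ W) :
    ∫ y, f y ∂(P (s + t) x) = ∫ z, ∫ y, f y ∂(P t z) ∂(P s x) := by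
  have := hP.isFiniteMeasure (s + t) x
  rw [hP.chapman_kolmogorov]
  refine Kernel.integral_comp ?_
  rw [← hP.chapman_kolmogorov]
  exact .of_bound hf.aestronglyMeasurable W (.of_forall hW)

/-- The transition semigroup as a kernel in time and space. -/
def timeSpaceKernel (P : ℝ≥0 → Kernel E E)
    (hm : Measurable fun p : ℝ≥0 × E => P p.1 p.2) : Kernel (ℝ≥0 × E) E :=
  ⟨fun p => P p.1 p.2, hm⟩

theorem IsTransitionSemigroup.measurable_integral (hP : IsTransitionSemigroup P)
    (hm : Measurable fun p : ℝ≥0 × E => P p.1 p.2) {G : ℝ≥0 × E → ℝ} (hG : Measurable G)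
    (t : ℝ≥0) :
    Measurable fun q : ℝ × E => ∫ y, G (q.1.toNNReal, y) ∂(P (t - q.1.toNNReal) q.2) := by
  have : IsFiniteKernel (timeSpaceKernel P hm) :=
    ⟨⟨1, ENNReal.one_lt_top, fun p => hP.mass_le_one p.1 p.2⟩⟩
  exact (StronglyMeasurable.integral_kernel_prod_right'
    (κ := (timeSpaceKernel P hm).comap (fun q : ℝ × E => (t - q.1.toNNReal, q.2))
      (((measurable_real_toNNReal.comp measurable_fst).const_sub t).prodMk measurable_snd))
    (f := fun q : (ℝ × E) × E => G (q.1.1.toNNReal, q.2))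
    (hG.comp ((measurable_real_toNNReal.comp measurable_fst.fst).prodMk
      measurable_snd)).stronglyMeasurable).measurable

theorem intervalIntegrable_of_measurable_of_abs_le {h : ℝ → ℝ} (hm : Measurable h) {a b C : ℝ}
    (hab : a ≤ b) (hC : ∀ s, a ≤ s → s ≤ b → |h s| ≤ C) : IntervalIntegrable h volume a b := by
  rw [intervalIntegrable_iff_integrableOn_Ioc_of_le hab]
  refine .of_bound (by simp) hm.aestronglyMeasurable C ?_
  filter_upwards [ae_restrict_mem measurableSet_Ioc] with s hs using hC s hs.1.le hs.2

end Semigroup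

/-! ### Evolution equation: flow property and killing. -/

namespace IsCumulant

variable {E : Type*} [MeasurableSpace E] {P : ℝ≥0 → Kernel E E} {φ : BranchingMechanism E}
  {f : E → ℝ} {V : ℝ≥0 → E → ℝ}

theorem measurable_apply (hV : IsCumulant P φ f V) (t : ℝ≥0) : Measurable (V t) :=
  hV.measurable.comp measurable_prodMk_left

theorem zero_eq [MeasurableSingletonClass E] (hP : IsTransitionSemigroup P)
    (hV : IsCumulant P φ f V) : V 0 = f := by
  ext x
  have := hV.equation 0 x
  simpa [hP.zero, Kernel.id_apply] using this

variable [MeasurableEq E]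

theorem measurable_eval (hV : IsCumulant P φ f V) :
    Measurable fun q : ℝ≥0 × E => φ.eval q.2 (V q.1) :=
  φ.measurable_eval hV.measurable

theorem measurable_eval_apply (hV : IsCumulant P φ f V) (t : ℝ≥0) :
    Measurable fun y => φ.eval y (V t) :=
  hV.measurable_eval.comp (measurable_prodMk_left (x := t))

theorem exists_eval_bound (hV : IsCumulant P φ f V) (T : ℝ≥0) :
    ∃ C : ℝ, 0 ≤ C ∧ ∀ t ≤ T, ∀ x, |φ.eval x (V t)| ≤ C := by
  obtain ⟨B, hB⟩ := hV.locally_bounded T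
  obtain ⟨C, hC⟩ := φ.exists_eval_bound B
  refine ⟨|C|, abs_nonneg C, fun t ht x => ?_⟩
  exact (hC x _ (hV.measurable_apply t) (hV.nonneg t) (hB t ht)).trans (le_abs_self C)

theorem measurable_integrand (hP : IsTransitionSemigroup P)
    (hm : Measurable fun p : ℝ≥0 × E => P p.1 p.2) (hV : IsCumulant P φ f V) (t : ℝ≥0) :
    Measurable fun q : ℝ × E =>
      ∫ y, φ.eval y (V q.1.toNNReal) ∂(P (t - q.1.toNNReal) q.2) :=
  hP.measurable_integral hm hV.measurable_eval t

theorem intervalIntegrable_integrand (hP : IsTransitionSemigroup P)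
    (hm : Measurable fun p : ℝ≥0 × E => P p.1 p.2) (hV : IsCumulant P φ f V) (t : ℝ≥0) (x : E)
    {a b : ℝ} (hab : a ≤ b) :
    IntervalIntegrable (fun s : ℝ => ∫ y, φ.eval y (V s.toNNReal) ∂(P (t - s.toNNReal) x))
      volume a b := by
  obtain ⟨C, hC0, hC⟩ := hV.exists_eval_bound b.toNNReal
  exact intervalIntegrable_of_measurable_of_abs_le
    ((hV.measurable_integrand hP hm t).comp measurable_prodMk_right) hab
    fun s _ hs => hP.abs_integral_le _ _ hC0 (hC _ (Real.toNNReal_le_toNNReal hs))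

/-- The value of `P_{t-s} V_s` obtained from the evolution equation at time `s`. -/
theorem integral_semigroup (hP : IsTransitionSemigroup P)
    (hm : Measurable fun p : ℝ≥0 × E => P p.1 p.2) (hf : Measurable f) {a : ℝ}
    (ha : ∀ y, |f y| ≤ a) (hV : IsCumulant P φ f V) {s t : ℝ≥0} (hst : s ≤ t) (x : E) :
    ∫ y, V s y ∂(P (t - s) x) = ∫ y, f y ∂(P t x)
      - ∫ r in (0 : ℝ)..s, ∫ y, φ.eval y (V r.toNNReal) ∂(P (t - r.toNNReal) x) := by
  have := hP.isFiniteMeasure (t - s) x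
  obtain ⟨C, hC0, hC⟩ := hV.exists_eval_bound s
  have hmeas := hV.measurable_integrand hP hm s
  have hs0 : (0 : ℝ) ≤ s := s.2
  have hbd : ∀ r : ℝ, r ≤ s → ∀ z, |∫ y, φ.eval y (V r.toNNReal) ∂(P (s - r.toNNReal) z)| ≤ C :=
    fun r hr z => hP.abs_integral_le _ _ hC0 (hC _ (Real.toNNReal_le_iff_le_coe.2 hr))
  -- Integrability for Fubini: `P_{t-s}` is applied to the equation at time `s`, moved inside the
  -- time integral, and merged with `P_{s-r}` into `P_{t-r}`.
  have hprod : Integrable (Function.uncurry fun (r : ℝ) (z : E) =>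
      ∫ y, φ.eval y (V r.toNNReal) ∂(P (s - r.toNNReal) z))
      ((volume.restrict (uIoc (0 : ℝ) s)).prod (P (t - s) x)) := by
    rw [uIoc_of_le hs0]
    refine .of_bound hmeas.aestronglyMeasurable C ?_
    have : ∀ᵐ q ∂((volume.restrict (Ioc (0 : ℝ) s)).prod (P (t - s) x)), q.1 ∈ Ioc (0 : ℝ) s :=
      Measure.quasiMeasurePreserving_fst.ae (ae_restrict_mem measurableSet_Ioc)
    filter_upwards [this] with q hq using hbd q.1 hq.2 q.2
  have hint : Integrable (fun z => ∫ r in (0 : ℝ)..s,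
      ∫ y, φ.eval y (V r.toNNReal) ∂(P (s - r.toNNReal) z)) (P (t - s) x) := by
    simp_rw [intervalIntegral.integral_of_le hs0]
    rw [uIoc_of_le hs0] at hprod
    exact hprod.integral_prod_right
  have hf' : Integrable (fun z => ∫ y, f y ∂(P s z)) (P (t - s) x) := by
    refine .of_bound (StronglyMeasurable.integral_kernel hf.stronglyMeasurable).aestronglyMeasurable
      |a| (.of_forall fun z => hP.abs_integral_le _ _ (abs_nonneg a)
        fun y => (ha y).trans (le_abs_self a))
  simp_rw [hV.equation s]
  rw [integral_sub hf' hint, ← hP.integral_add _ _ _ hf ha, tsub_add_cancel_of_le hst,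
    ← intervalIntegral_integral_swap hprod]
  congr 1
  refine intervalIntegral.integral_congr fun r hr => ?_
  rw [uIcc_of_le hs0] at hr
  have hrs : r.toNNReal ≤ s := Real.toNNReal_le_iff_le_coe.2 hr.2
  rw [← hP.integral_add _ _ _ (hV.measurable_eval_apply _) (hC _ hrs),
    tsub_add_tsub_cancel hst hrs]

/-- Flow property: a cumulant restarted at time `T`. -/
theorem restart (hP : IsTransitionSemigroup P)
    (hm : Measurable fun p : ℝ≥0 × E => P p.1 p.2) (hf : Measurable f) {a : ℝ}
    (ha : ∀ y, |f y| ≤ a) (hV : IsCumulant P φ f V) (T : ℝ≥0) :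
    IsCumulant P φ (V T) (fun t => V (T + t)) where
  measurable := hV.measurable.comp ((measurable_fst.const_add T).prodMk measurable_snd)
  nonneg t x := hV.nonneg _ x
  locally_bounded S := by
    obtain ⟨K, hK⟩ := hV.locally_bounded (T + S)
    exact ⟨K, fun t ht x => hK _ (add_le_add_right ht T) x⟩
  equation t x := by
    have h1 := hV.integral_semigroup hP hm hf ha (le_self_add : T ≤ T + t) x
    rw [add_tsub_cancel_left] at h1
    have h2 := intervalIntegral.integral_add_adjacent_intervals
      (hV.intervalIntegrable_integrand hP hm (T + t) x T.coe_nonneg)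
      (hV.intervalIntegrable_integrand hP hm (T + t) x (a := T) (b := (T + t : ℝ≥0))
        (by exact_mod_cast (le_self_add : T ≤ T + t)))
    have h3 : ∫ s in (0 : ℝ)..t, ∫ y, φ.eval y (V (T + s.toNNReal)) ∂(P (t - s.toNNReal) x)
        = ∫ s in (T : ℝ)..(T + t : ℝ≥0),
          ∫ y, φ.eval y (V s.toNNReal) ∂(P (T + t - s.toNNReal) x) := by
      have := intervalIntegral.integral_comp_add_left (a := 0) (b := t)
        (fun s : ℝ => ∫ y, φ.eval y (V s.toNNReal) ∂(P (T + t - s.toNNReal) x)) (T : ℝ)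
      rw [add_zero] at this
      rw [NNReal.coe_add, ← this]
      refine intervalIntegral.integral_congr fun s hs => ?_
      rw [uIcc_of_le t.coe_nonneg] at hs
      rw [Real.toNNReal_add T.coe_nonneg hs.1, Real.toNNReal_coe, add_tsub_add_eq_tsub_left]
    rw [hV.equation, h1, h3]
    linarith [h2]

/-- The evolution equation with an additional killing rate `K`. -/
theorem equation_killed (hP : IsTransitionSemigroup P)
    (hm : Measurable fun p : ℝ≥0 × E => P p.1 p.2) (hf : Measurable f) {a : ℝ}
    (ha : ∀ y, |f y| ≤ a) (hV : IsCumulant P φ f V) (K : ℝ) (t : ℝ≥0) (x : E) :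
    V t x = Real.exp (-(K * t)) * ∫ y, f y ∂(P t x)
      + ∫ s in (0 : ℝ)..t, Real.exp (-(K * (t - s))) *
        ∫ y, (K * V s.toNNReal y - φ.eval y (V s.toNNReal)) ∂(P (t - s.toNNReal) x) := by
  -- Along `s`, the path `P_{t-s} V_s(x)` is `P_t f(x)` minus a primitive, so variation of constants
  -- applies to it.
  have h := integral_exp_mul_sub_primitive
    (hV.intervalIntegrable_integrand hP hm t x t.coe_nonneg) K (∫ y, f y ∂(P t x))
  rw [← hV.equation t x] at h
  have e : ∫ s in (0 : ℝ)..t, Real.exp (-(K * (t - s))) *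
        ∫ y, (K * V s.toNNReal y - φ.eval y (V s.toNNReal)) ∂(P (t - s.toNNReal) x)
      = V t x - Real.exp (-(K * t)) * ∫ y, f y ∂(P t x) := by
    rw [← h]
    refine intervalIntegral.integral_congr fun s hs => ?_
    rw [uIcc_of_le t.coe_nonneg] at hs
    have hst : s.toNNReal ≤ t := Real.toNNReal_le_iff_le_coe.2 hs.2
    have := hP.isFiniteMeasure (t - s.toNNReal) x
    obtain ⟨C, -, hC⟩ := hV.exists_eval_bound t
    obtain ⟨B, hB⟩ := hV.locally_bounded t
    rw [integral_sub ((integrable_of_measurable_of_bounds _ (hV.measurable_apply _)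
      (hV.nonneg _) (hB _ hst)).const_mul K)
      (.of_bound (hV.measurable_eval_apply _).aestronglyMeasurable C
        (.of_forall (hC _ hst))), integral_const_mul,
      hV.integral_semigroup hP hm hf ha hst x, Real.coe_toNNReal s hs.1]
  rw [e]; ring

end IsCumulant

/-! ### Comparison with exponentials. -/

/-- Adding `a e^{-Kt}` to the right side reproduces `a e^{-rt}`, so this profile is a fixed point of
the killed linear equation, while the constant excess `S` is damped. -/
theorem integral_exp_kill_mul {K : ℝ} (hK : K ≠ 0) (r a S t : ℝ) :
    ∫ s in (0 : ℝ)..t, Real.exp (-(K * (t - s))) * ((K - r) * (a * Real.exp (-(r * s)) + S))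
      = a * (Real.exp (-(r * t)) - Real.exp (-(K * t)))
        + S * ((K - r) / K) * (1 - Real.exp (-(K * t))) := by
  have h : ∀ s : ℝ, HasDerivAt
      (fun s => Real.exp (-(K * (t - s))) * (a * Real.exp (-(r * s)) + S * ((K - r) / K)))
      (Real.exp (-(K * (t - s))) * ((K - r) * (a * Real.exp (-(r * s)) + S))) s := fun s => by
    have h1 : HasDerivAt (fun s => Real.exp (-(K * (t - s)))) (Real.exp (-(K * (t - s))) * K) s := by
      simpa using (((hasDerivAt_id s).const_sub t).const_mul K).neg.exp
    have h2 : HasDerivAt (fun s => a * Real.exp (-(r * s)) + S * ((K - r) / K))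
        (a * (Real.exp (-(r * s)) * -r)) s := by
      simpa using ((((hasDerivAt_id s).const_mul r).neg.exp).const_mul a).add_const
        (S * ((K - r) / K))
    refine (h1.mul h2).congr_deriv ?_
    field_simp
    ring
  rw [intervalIntegral.integral_eq_sub_of_hasDerivAt (fun s _ => h s)
    (Continuous.intervalIntegrable (by fun_prop) _ _)]
  simp only [sub_self, mul_zero, neg_zero, Real.exp_zero, sub_zero]
  ring

namespace IsCumulant

variable {E : Type*} [MeasurableSpace E] [MeasurableEq E] {P : ℝ≥0 → Kernel E E}
  {φ : BranchingMechanism E} {f : E → ℝ} {V : ℝ≥0 → E → ℝ}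

/-- One contraction step towards the comparison of a cumulant with `a e^{-rt}`. -/
theorem le_exp_add (hP : IsTransitionSemigroup P)
    (hm : Measurable fun p : ℝ≥0 × E => P p.1 p.2) (hf : Measurable f) {a : ℝ}
    (hf0 : ∀ y, 0 ≤ f y) (ha0 : 0 ≤ a) (hfa : ∀ y, f y ≤ a) (hV : IsCumulant P φ f V)
    {r z₀ K S M : ℝ} {T : ℝ≥0} (hr : 0 ≤ r) (hrz : ∀ x z, z₀ ≤ z → r * z ≤ φ.localProjection x z)
    (hT : z₀ ≤ a * Real.exp (-(r * T))) (hK0 : 0 < K) (hKr : r ≤ K)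
    (hK : ∀ (x : E) (f : E → ℝ) (W : ℝ), Measurable f → (∀ y, 0 ≤ f y) → (∀ y, f y ≤ W) →
      W ≤ M → K * f x - φ.eval x f ≤ K * W - φ.localProjection x W)
    (hS : 0 ≤ S) (hSM : a + S ≤ M)
    (hVS : ∀ t ≤ T, ∀ x, V t x ≤ a * Real.exp (-(r * t)) + S) :
    ∀ t ≤ T, ∀ x, V t x ≤ a * Real.exp (-(r * t)) + (1 - Real.exp (-(K * T))) * S := by
  intro t ht x
  have ht0 : (0 : ℝ) ≤ t := t.coe_nonneg
  have htT : (t : ℝ) ≤ T := ht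
  have hKr0 : 0 ≤ K - r := sub_nonneg.2 hKr
  rw [hV.equation_killed hP hm hf (fun y => by rw [abs_of_nonneg (hf0 y)]; exact hfa y) K t x]
  have hPf : ∫ y, f y ∂(P t x) ≤ a := by
    have := hP.isFiniteMeasure t x
    exact hP.integral_le t x ha0 hfa (integrable_of_measurable_of_bounds _ hf hf0 hfa)
  obtain ⟨C, hC0, hC⟩ := hV.exists_eval_bound t
  obtain ⟨B, hB⟩ := hV.locally_bounded t
  have hmeasG : Measurable fun q : ℝ≥0 × E => K * V q.1 q.2 - φ.eval q.2 (V q.1) :=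
    (hV.measurable.const_mul K).sub hV.measurable_eval
  have hGm : ∀ s : ℝ≥0, Measurable fun y => K * V s y - φ.eval y (V s) := fun s =>
    hmeasG.comp (measurable_prodMk_left (x := s))
  have hGb : ∀ s ≤ t, ∀ y, |K * V s y - φ.eval y (V s)| ≤ K * |B| + C := fun s hs y => by
    refine (abs_sub _ _).trans (add_le_add ?_ (hC s hs y))
    rw [abs_mul, abs_of_pos hK0, abs_of_nonneg (hV.nonneg s y)]
    exact mul_le_mul_of_nonneg_left ((hB s hs y).trans (le_abs_self B)) hK0.le
  -- With `W` the current upper bound at time `s`, comparison gives `K W - φ₁(y,W) ≤ (K - r) W`. The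
  -- rate `r` applies because `W` is still above `z₀` up to time `T`.
  have hGle : ∀ s : ℝ, 0 ≤ s → s ≤ t →
      ∫ y, (K * V s.toNNReal y - φ.eval y (V s.toNNReal)) ∂(P (t - s.toNNReal) x)
        ≤ (K - r) * (a * Real.exp (-(r * s)) + S) := by
    intro s hs0 hst
    have hst' : s.toNNReal ≤ t := Real.toNNReal_le_iff_le_coe.2 hst
    have := hP.isFiniteMeasure (t - s.toNNReal) x
    refine hP.integral_le _ _ (by positivity) (fun y => ?_)
      (.of_bound (hGm _).aestronglyMeasurable _ (.of_forall (hGb _ hst')))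
    set W := a * Real.exp (-(r * s)) + S
    have hVW : ∀ y, V s.toNNReal y ≤ W := fun y => by
      have := hVS _ (hst'.trans ht) y
      rwa [Real.coe_toNNReal s hs0] at this
    have he : Real.exp (-(r * s)) ≤ 1 := Real.exp_le_one_iff.2 (by nlinarith)
    have hWM : W ≤ M := by
      refine le_trans ?_ hSM
      have := mul_le_mul_of_nonneg_left he ha0
      simp only [W]; linarith
    have hzW : z₀ ≤ W := by
      refine hT.trans ?_
      have : Real.exp (-(r * T)) ≤ Real.exp (-(r * s)) :=
        Real.exp_le_exp.2 (by nlinarith)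
      have := mul_le_mul_of_nonneg_left this ha0
      simp only [W]; linarith
    have := hK y _ W (hV.measurable_apply _) (hV.nonneg _) hVW hWM
    linarith [hrz y W hzW]
  have hint : ∫ s in (0 : ℝ)..t, Real.exp (-(K * (t - s))) *
        ∫ y, (K * V s.toNNReal y - φ.eval y (V s.toNNReal)) ∂(P (t - s.toNNReal) x)
      ≤ ∫ s in (0 : ℝ)..t, Real.exp (-(K * (t - s))) *
        ((K - r) * (a * Real.exp (-(r * s)) + S)) := by
    refine intervalIntegral.integral_mono_on ht0 ?_
      (Continuous.intervalIntegrable (by fun_prop) _ _) fun s hs =>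
        mul_le_mul_of_nonneg_left (hGle s hs.1 hs.2) (Real.exp_pos _).le
    have hmI : Measurable fun s : ℝ =>
        ∫ y, (K * V s.toNNReal y - φ.eval y (V s.toNNReal)) ∂(P (t - s.toNNReal) x) :=
      (hP.measurable_integral hm hmeasG t).comp (measurable_prodMk_right (y := x))
    refine IntervalIntegrable.continuousOn_mul ?_ (Continuous.continuousOn (by fun_prop))
    exact intervalIntegrable_of_measurable_of_abs_le hmI ht0 (C := K * |B| + C) fun s _ hs =>
      hP.abs_integral_le _ _ (by positivity) (hGb _ (Real.toNNReal_le_iff_le_coe.2 hs))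
  rw [integral_exp_kill_mul hK0.ne'] at hint
  have e1 : Real.exp (-(K * t)) * ∫ y, f y ∂(P t x) ≤ Real.exp (-(K * t)) * a :=
    mul_le_mul_of_nonneg_left hPf (Real.exp_pos _).le
  -- The factor `(K - r)/K ≤ 1` is discarded, so contraction comes from the finite horizon alone and
  -- `r = 0` is allowed.
  have e2 : S * ((K - r) / K) * (1 - Real.exp (-(K * t))) ≤ (1 - Real.exp (-(K * T))) * S := by
    have h1 : (K - r) / K ≤ 1 := by rw [div_le_one hK0]; linarith
    have h1' : 0 ≤ (K - r) / K := by positivity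
    have h2 : Real.exp (-(K * T)) ≤ Real.exp (-(K * t)) := Real.exp_le_exp.2 (by nlinarith)
    have h3 : Real.exp (-(K * t)) ≤ 1 := Real.exp_le_one_iff.2 (by nlinarith)
    have h4 : (K - r) / K * (1 - Real.exp (-(K * t))) ≤ 1 * (1 - Real.exp (-(K * T))) :=
      mul_le_mul h1 (by linarith) (by linarith) zero_le_one
    have := mul_le_mul_of_nonneg_left h4 hS
    linarith
  linarith

/-- Comparison principle: if `φ₁(x, z) ≥ r z` for `z ≥ z₀`, then a cumulant started below `a`
stays below `a e^{-rt}` as long as `a e^{-rt} ≥ z₀`. -/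
theorem le_exp (hP : IsTransitionSemigroup P)
    (hm : Measurable fun p : ℝ≥0 × E => P p.1 p.2) (hf : Measurable f) {a : ℝ}
    (hf0 : ∀ y, 0 ≤ f y) (ha0 : 0 ≤ a) (hfa : ∀ y, f y ≤ a) (hV : IsCumulant P φ f V)
    {r z₀ : ℝ} {T : ℝ≥0} (hr : 0 ≤ r) (hrz : ∀ x z, z₀ ≤ z → r * z ≤ φ.localProjection x z)
    (hT : z₀ ≤ a * Real.exp (-(r * T))) :
    ∀ t ≤ T, ∀ x, V t x ≤ a * Real.exp (-(r * t)) := by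
  obtain ⟨B, hB⟩ := hV.locally_bounded T
  -- The excesses `q ^ n * |B|` never exceed `|B|`, so one constant `K` serves all iterations.
  obtain ⟨K₀, hK₀⟩ := φ.exists_comparison_const (a + |B|)
  set K := max K₀ (r + 1)
  have hK := hK₀ K (le_max_left _ _)
  have hKr : r + 1 ≤ K := le_max_right _ _
  have hK0 : 0 < K := by linarith
  set q := 1 - Real.exp (-(K * T)) with hq
  have hq1 : q < 1 := by linarith [Real.exp_pos (-(K * T))]
  have hq0 : 0 ≤ q := by
    have : Real.exp (-(K * T)) ≤ 1 :=
      Real.exp_le_one_iff.2 (by have := mul_nonneg hK0.le T.coe_nonneg; linarith)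
    linarith
  have key : ∀ n : ℕ, ∀ t ≤ T, ∀ x, V t x ≤ a * Real.exp (-(r * t)) + q ^ n * |B| := by
    intro n
    induction n with
    | zero =>
      intro t ht x
      have h1 := (hB t ht x).trans (le_abs_self B)
      have h2 : 0 ≤ a * Real.exp (-(r * t)) := by positivity
      linarith
    | succ n ih =>
      have hle : q ^ n * |B| ≤ |B| :=
        mul_le_of_le_one_left (abs_nonneg B) (pow_le_one₀ hq0 hq1.le)
      have := hV.le_exp_add hP hm hf hf0 ha0 hfa hr hrz hT hK0 (by linarith) hK
        (by positivity) (by linarith) ih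
      intro t ht x
      rw [pow_succ', mul_assoc]
      exact this t ht x
  intro t ht x
  have hlim : Tendsto (fun n : ℕ => a * Real.exp (-(r * t)) + q ^ n * |B|) atTop
      (𝓝 (a * Real.exp (-(r * t)) + 0 * |B|)) :=
    ((tendsto_pow_atTop_nhds_zero_of_lt_one hq0 hq1).mul_const _).const_add _
  rw [zero_mul, add_zero] at hlim
  exact ge_of_tendsto' hlim fun n => key n t ht x

end IsCumulant

/-! ### The spatially independent mechanism and Grey's condition. -/

namespace CBMechanism

variable (ψ : CBMechanism)

theorem integrable_jump {z : ℝ} (hz : 0 ≤ z) :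
    Integrable (fun u => Real.exp (-(z * u)) - 1 + z * u) (ψ.m.restrict (Ioi 0)) := by
  have hi : Integrable (fun u : ℝ => min u (u ^ 2)) (ψ.m.restrict (Ioi 0)) := by
    refine ⟨(by fun_prop : Measurable fun u : ℝ => min u (u ^ 2)).aestronglyMeasurable, ?_⟩
    rw [hasFiniteIntegral_iff_ofReal]
    · exact ψ.finite_m
    · filter_upwards [ae_restrict_mem measurableSet_Ioi] with u hu
      exact le_min (le_of_lt hu) (sq_nonneg u)
  refine (hi.const_mul (z + z ^ 2)).mono'
    (by fun_prop : Measurable fun u : ℝ => Real.exp (-(z * u)) - 1 + z * u).aestronglyMeasurable ?_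
  filter_upwards [ae_restrict_mem measurableSet_Ioi] with u hu
  rw [Real.norm_of_nonneg (exp_neg_sub_one_add_nonneg _)]
  exact exp_neg_sub_one_add_le_min hz (le_of_lt hu)

/-- Monotonicity of `φ_*(z)/z`: this turns the value at one level into a linear lower bound at all
higher levels. -/
theorem mul_eval_le {y z : ℝ} (hy : 0 ≤ y) (hyz : y ≤ z) : z * ψ.eval y ≤ y * ψ.eval z := by
  have hz := hy.trans hyz
  have h1 : z * ∫ u in Ioi (0 : ℝ), (Real.exp (-(y * u)) - 1 + y * u) ∂ψ.m
      ≤ y * ∫ u in Ioi (0 : ℝ), (Real.exp (-(z * u)) - 1 + z * u) ∂ψ.m := by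
    rw [← integral_const_mul, ← integral_const_mul]
    exact integral_mono ((ψ.integrable_jump hy).const_mul z) ((ψ.integrable_jump hz).const_mul y)
      fun u => mul_exp_neg_sub_one_add_le hy hyz
  have h2 : z * (ψ.c * y ^ 2) ≤ y * (ψ.c * z ^ 2) := by
    have := mul_nonneg (mul_nonneg ψ.c_nonneg (mul_nonneg hy hz)) (sub_nonneg.2 hyz)
    nlinarith
  rw [eval, eval]
  linarith

theorem eval_mono {y z : ℝ} (hy : 0 < y) (hyz : y ≤ z) (h : 0 ≤ ψ.eval y) :
    ψ.eval y ≤ ψ.eval z := by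
  have h1 := ψ.mul_eval_le hy.le hyz
  have h2 := mul_le_mul_of_nonneg_right hyz h
  exact le_of_mul_le_mul_left (h2.trans h1) hy

/-- Grey's condition in dyadic form. -/
theorem Grey.exists_sum_le {ψ : CBMechanism} (h : ψ.Grey) : ∃ z₀ : ℝ, 0 < z₀ ∧
    (∀ z, z₀ ≤ z → 0 < ψ.eval z) ∧
    ∃ C : ℝ, ∀ n : ℕ, ∑ k ∈ Finset.range n, z₀ * 2 ^ k / ψ.eval (z₀ * 2 ^ k) ≤ C := by
  obtain ⟨z₀, hz₀, hpos, hint⟩ := h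
  refine ⟨z₀, hz₀, hpos, z₀ / ψ.eval z₀ + 2 * ∫ z in Ioi z₀, (ψ.eval z)⁻¹, fun n => ?_⟩
  set w : ℕ → ℝ := fun k => z₀ * 2 ^ k with hw
  have hw0 : ∀ k, z₀ ≤ w k := fun k => le_mul_of_one_le_right hz₀.le (one_le_pow₀ one_le_two)
  have hwpos : ∀ k, 0 < w k := fun k => hz₀.trans_le (hw0 k)
  have hws : ∀ k, w (k + 1) = 2 * w k := fun k => by simp only [hw, pow_succ]; ring
  have hws' : ∀ k, w k ≤ w (k + 1) := fun k => by rw [hws]; linarith [hwpos k]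
  have hII : ∀ k, IntervalIntegrable (fun z => (ψ.eval z)⁻¹) volume (w k) (w (k + 1)) := fun k => by
    rw [intervalIntegrable_iff_integrableOn_Ioc_of_le (hws' k)]
    exact hint.mono_set fun z hz => (hw0 k).trans_lt hz.1
  -- The interval has length `w (k + 1) / 2`, and the reciprocal is smallest at its right end.
  have hstep : ∀ k, w (k + 1) / ψ.eval (w (k + 1)) ≤
      2 * ∫ z in (w k)..(w (k + 1)), (ψ.eval z)⁻¹ := fun k => by
    have h1 : ∫ _ in (w k)..(w (k + 1)), (ψ.eval (w (k + 1)))⁻¹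
        ≤ ∫ z in (w k)..(w (k + 1)), (ψ.eval z)⁻¹ := by
      refine intervalIntegral.integral_mono_on (hws' k) (by simp) (hII k) fun z hz => ?_
      have hz0 : z₀ ≤ z := (hw0 k).trans hz.1
      exact inv_anti₀ (hpos z hz0) (ψ.eval_mono (hz₀.trans_le hz0) hz.2 (hpos z hz0).le)
    rw [intervalIntegral.integral_const, smul_eq_mul] at h1
    refine le_trans (le_of_eq ?_) (mul_le_mul_of_nonneg_left h1 zero_le_two)
    rw [hws, div_eq_mul_inv]; ring
  have htot : ∑ k ∈ Finset.range n, ∫ z in (w k)..(w (k + 1)), (ψ.eval z)⁻¹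
      ≤ ∫ z in Ioi z₀, (ψ.eval z)⁻¹ := by
    rw [intervalIntegral.sum_integral_adjacent_intervals fun k _ => hII k,
      intervalIntegral.integral_of_le (monotone_nat_of_le_succ hws' (Nat.zero_le n))]
    refine setIntegral_mono_set hint ?_ (.of_forall fun z hz => (hw0 0).trans_lt hz.1)
    filter_upwards [ae_restrict_mem measurableSet_Ioi] with z hz
    exact (inv_pos.2 (hpos z (le_of_lt hz))).le
  -- The term `k = 0` has no dyadic interval to its left and is kept separately; one extra term at
  -- the top makes the split uniform in `n`.
  have hle : ∑ k ∈ Finset.range (n + 1), w k / ψ.eval (w k)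
      ≤ z₀ / ψ.eval z₀ + 2 * ∫ z in Ioi z₀, (ψ.eval z)⁻¹ := by
    rw [Finset.sum_range_succ', add_comm]
    refine add_le_add (by simp [hw]) ?_
    refine (Finset.sum_le_sum fun k _ => hstep k).trans ?_
    rw [← Finset.mul_sum]
    exact mul_le_mul_of_nonneg_left htot zero_le_two
  refine le_trans ?_ hle
  exact Finset.sum_le_sum_of_subset_of_nonneg (Finset.range_subset_range.2 n.le_succ)
    fun k _ _ => div_nonneg (hwpos k).le (hpos _ (hw0 k)).le

end CBMechanism

/-! ### Uniform decay of cumulants. -/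

variable {E : Type*} [MeasurableSpace E] [MeasurableEq E] {P : ℝ≥0 → Kernel E E}
  {φ : BranchingMechanism E}

/-- Descent from infinity: under Grey's condition all cumulants, whatever their initial value,
have come below a fixed level before a fixed time. -/
theorem exists_descent_time (hP : IsTransitionSemigroup P)
    (hm : Measurable fun p : ℝ≥0 × E => P p.1 p.2) {ψ : CBMechanism}
    (hbelow : ∀ (x : E) (z : ℝ), 0 ≤ z → ψ.eval z ≤ φ.localProjection x z) (hψ : ψ.Grey) :
    ∃ z₀ : ℝ, 0 < z₀ ∧ ∃ T : ℝ≥0, ∀ (n : ℕ) (f : E → ℝ) (V : ℝ≥0 → E → ℝ), Measurable f →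
      (∀ y, 0 ≤ f y) → (∀ y, f y ≤ z₀ * 2 ^ n) → IsCumulant P φ f V →
      ∃ S ≤ T, ∀ x, V S x ≤ z₀ := by
  obtain ⟨z₀, hz₀, hpos, C, hC⟩ := hψ.exists_sum_le
  set w : ℕ → ℝ := fun k => z₀ * 2 ^ k with hw
  have hw0 : ∀ k, z₀ ≤ w k := fun k => le_mul_of_one_le_right hz₀.le (one_le_pow₀ one_le_two)
  have hwpos : ∀ k, 0 < w k := fun k => hz₀.trans_le (hw0 k)
  have hlog : 0 < Real.log 2 := Real.log_pos one_lt_two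
  let τ : ℕ → ℝ≥0 := fun k => (Real.log 2 * (w k / ψ.eval (w k))).toNNReal
  have hτ : ∀ k, (τ k : ℝ) = Real.log 2 * (w k / ψ.eval (w k)) := fun k =>
    Real.coe_toNNReal _ (mul_nonneg hlog.le (div_nonneg (hwpos k).le (hpos _ (hw0 k)).le))
  have hsum : ∀ n, ∑ k ∈ Finset.range n, τ k ≤ (Real.log 2 * C).toNNReal := fun n => by
    refine NNReal.coe_le_coe.1 (le_trans ?_ (Real.le_coe_toNNReal _))
    rw [NNReal.coe_sum]
    simp_rw [hτ]
    rw [← Finset.mul_sum]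
    exact mul_le_mul_of_nonneg_left (hC n) hlog.le
  have key : ∀ (n : ℕ) (f : E → ℝ) (V : ℝ≥0 → E → ℝ), Measurable f →
      (∀ y, 0 ≤ f y) → (∀ y, f y ≤ w n) → IsCumulant P φ f V →
      ∃ S ≤ ∑ k ∈ Finset.range n, τ k, ∀ x, V S x ≤ z₀ := by
    intro n
    induction n with
    | zero =>
      intro f V _ _ hfa hV
      exact ⟨0, by simp, fun x => by rw [hV.zero_eq hP]; simpa [hw] using hfa x⟩
    | succ n ih =>
      intro f V hf hf0 hfa hV
      -- Decay rate valid above level `w n`; the time `τ n` is chosen to halve `w (n + 1)` at this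
      -- rate.
      have hr : 0 < ψ.eval (w n) / w n := div_pos (hpos _ (hw0 n)) (hwpos n)
      have hdecay : w (n + 1) * Real.exp (-(ψ.eval (w n) / w n * τ n)) = w n := by
        have : ψ.eval (w n) / w n * τ n = Real.log 2 := by
          rw [hτ]
          have := (hwpos n).ne'
          have := (hpos _ (hw0 n)).ne'
          field_simp
        rw [this, Real.exp_neg, Real.exp_log two_pos]
        simp only [hw, pow_succ]
        ring
      have hrz : ∀ x z, w n ≤ z → ψ.eval (w n) / w n * z ≤ φ.localProjection x z := by
        intro x z hz
        refine le_trans ?_ (hbelow x z ((hwpos n).le.trans hz))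
        rw [div_mul_eq_mul_div, div_le_iff₀ (hwpos n)]
        linarith [ψ.mul_eval_le (hwpos n).le hz]
      have h1 := hV.le_exp hP hm hf hf0 (hwpos (n + 1)).le hfa hr.le hrz hdecay.ge (τ n) le_rfl
      rw [hdecay] at h1
      obtain ⟨S, hS, hSx⟩ := ih _ _ (hV.measurable_apply (τ n)) (hV.nonneg _) h1
        (hV.restart hP hm hf (fun y => by rw [abs_of_nonneg (hf0 y)]; exact hfa y) (τ n))
      refine ⟨τ n + S, ?_, hSx⟩
      rw [Finset.sum_range_succ, add_comm]
      exact add_le_add_left hS _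
  refine ⟨z₀, hz₀, (Real.log 2 * C).toNNReal, fun n f V hf hf0 hfa hV => ?_⟩
  obtain ⟨S, hS, hSx⟩ := key n f V hf hf0 hfa hV
  exact ⟨S, hS.trans (hsum n), hSx⟩

/-- Exponential decay of cumulants, uniformly in the initial value. -/
theorem exists_uniform_decay (hP : IsTransitionSemigroup P)
    (hm : Measurable fun p : ℝ≥0 × E => P p.1 p.2) {ψ : CBMechanism}
    (hbelow : ∀ (x : E) (z : ℝ), 0 ≤ z → ψ.eval z ≤ φ.localProjection x z) (hψ : ψ.Grey)
    (hβ : 0 < φ.betaStar) :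
    ∃ D : ℝ, 0 ≤ D ∧ ∃ T : ℝ≥0, ∀ (f : E → ℝ) (V : ℝ≥0 → E → ℝ), Measurable f →
      (∀ y, 0 ≤ f y) → (∃ a, ∀ y, f y ≤ a) → IsCumulant P φ f V →
      ∀ t, T ≤ t → ∀ x, V t x ≤ D * Real.exp (-(φ.betaStar * t)) := by
  obtain ⟨z₀, hz₀, T, hT⟩ := exists_descent_time hP hm hbelow hψ
  -- The descent time `S` depends on `f`; `S ≤ T` turns `z₀ e^{-β_*(t-S)}` into a bound free of `S`.
  refine ⟨z₀ * Real.exp (φ.betaStar * T), by positivity, T, ?_⟩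
  rintro f V hf hf0 ⟨a, ha⟩ hV t hTt x
  obtain ⟨n, hn⟩ := pow_unbounded_of_one_lt (a / z₀) one_lt_two
  have han : a ≤ z₀ * 2 ^ n := by
    rw [div_lt_iff₀ hz₀] at hn; linarith
  obtain ⟨S, hST, hS⟩ := hT n f V hf hf0 (fun y => (ha y).trans han) hV
  have hSt : S ≤ t := hST.trans hTt
  have h := (hV.restart hP hm hf (fun y => by rw [abs_of_nonneg (hf0 y)]; exact ha y) S).le_exp
    -- The bound by `β_* z` holds for every `z ≥ 0`, so the comparison has no floor.
    hP hm (hV.measurable_apply S) (hV.nonneg S) hz₀.le hS (T := t - S) (z₀ := 0) hβ.le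
    (fun x z hz => φ.betaStar_mul_le_localProjection x hz) (by positivity) (t - S) le_rfl x
  rw [add_tsub_cancel_of_le hSt, NNReal.coe_sub hSt] at h
  refine h.trans ?_
  rw [mul_assoc, ← Real.exp_add]
  refine mul_le_mul_of_nonneg_left (Real.exp_le_exp.2 ?_) hz₀.le
  have : φ.betaStar * S ≤ φ.betaStar * T := mul_le_mul_of_nonneg_left hST hβ.le
  linarith

/-! ### Total variation and the extinction probability. -/

/-- The total variation distance of a probability measure to a Dirac mass. -/
theorem tvDist_dirac {S : Type*} [MeasurableSpace S] (μ : Measure S) [IsProbabilityMeasure μ]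
    {a : S} (ha : MeasurableSet {a}) :
    tvDist μ (Measure.dirac a) = 2 * (1 - μ.real {a}) := by
  -- These are the positive and negative parts of the Jordan decomposition, both of mass `μ({a}ᶜ)`.
  have hsing : μ.restrict {a}ᶜ ⟂ₘ μ {a}ᶜ • Measure.dirac a := by
    refine ⟨{a}, ha, by rw [Measure.restrict_apply ha]; simp, ?_⟩
    simp [Measure.dirac_apply' a ha.compl]
  have : IsFiniteMeasure (μ {a}ᶜ • Measure.dirac a) := 
    Measure.smul_finite _ (measure_ne_top _ _)
  let j : JordanDecomposition S := ⟨μ.restrict {a}ᶜ, μ {a}ᶜ • Measure.dirac a, hsing⟩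
  have hc : μ.real {a}ᶜ = 1 - μ.real {a} := probReal_compl_eq_one_sub ha
  have hj : μ.toSignedMeasure - (Measure.dirac a).toSignedMeasure = j.toSignedMeasure := by
    ext s hs
    rw [JordanDecomposition.toSignedMeasure, sub_apply, sub_apply]
    simp only [Measure.toSignedMeasure_apply_measurable hs, j]
    rw [measureReal_restrict_apply hs, measureReal_ennreal_smul_apply, ← measureReal_def, hc]
    have h1 := measureReal_inter_add_sdiff (μ := μ) (s := s) ha
    rw [← sdiff_eq]
    by_cases has : a ∈ s
    · have e : s ∩ {a} = {a} := by simpa using has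
      have hd : (Measure.dirac a).real s = 1 := by
        rw [measureReal_def, Measure.dirac_apply' a hs]; simp [has]
      rw [e] at h1
      rw [hd]; linarith
    · have e : s ∩ {a} = ∅ := by ext x; simp; rintro hx rfl; exact has hx
      have hd : (Measure.dirac a).real s = 0 := by
        rw [measureReal_def, Measure.dirac_apply' a hs]; simp [has]
      rw [e, measureReal_empty] at h1
      rw [hd]; linarith
  rw [tvDist, SignedMeasure.totalVariation, SignedMeasure.toJordanDecomposition_eq hj]
  simp only [j]
  rw [measureReal_add_apply, measureReal_restrict_apply_univ, measureReal_ennreal_smul_apply,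
    ← measureReal_def, hc, probReal_univ]
  ring

theorem measurableSet_singleton_zero_finiteMeasure {E : Type*} [MeasurableSpace E] :
    MeasurableSet ({0} : Set (FiniteMeasure E)) := by
  have h : ({0} : Set (FiniteMeasure E)) =
      (fun ν : FiniteMeasure E => (ν : Measure E) univ) ⁻¹' {0} := by
    ext ν
    simp only [mem_singleton_iff, mem_preimage, Measure.measure_univ_eq_zero]
    exact ⟨fun h => by rw [h]; rfl, fun h => Subtype.ext h⟩
  rw [h]
  exact ((Measure.measurable_coe MeasurableSet.univ).comp measurable_subtype_coe)
    (measurableSet_singleton 0)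

/-- The Laplace functional at large constants approximates the mass of the zero measure. -/
theorem tendsto_laplace_const {E : Type*} [MeasurableSpace E] (Q : Measure (FiniteMeasure E))
    [IsFiniteMeasure Q] :
    Tendsto (fun n : ℕ => ∫ ν : FiniteMeasure E, Real.exp (-∫ _, (n : ℝ) ∂(ν : Measure E)) ∂Q)
      atTop (𝓝 (Q.real {0})) := by
  have h0 := measurableSet_singleton_zero_finiteMeasure (E := E)
  have hlim : Q.real {0} = ∫ ν, ({0} : Set (FiniteMeasure E)).indicator 1 ν ∂Q :=
    (integral_indicator_one h0).symm
  rw [hlim]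
  have hmass : Measurable fun ν : FiniteMeasure E => (ν : Measure E).real univ :=
    ((Measure.measurable_coe MeasurableSet.univ).comp measurable_subtype_coe).ennreal_toReal
  simp only [integral_const, smul_eq_mul]
  refine tendsto_integral_of_dominated_convergence (fun _ => 1)
    (fun n => (Real.measurable_exp.comp (hmass.mul_const _).neg).aestronglyMeasurable)
    (integrable_const _) (fun n => .of_forall fun ν => ?_) (.of_forall fun ν => ?_)
  · rw [Real.norm_of_nonneg (Real.exp_pos _).le, Real.exp_le_one_iff, neg_nonpos]
    positivity
  · by_cases hν : ν = 0
    · subst hν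
      simp
    · rw [indicator_of_notMem (by simpa using hν)]
      have hpos : 0 < (ν : Measure E).real univ := by
        rw [measureReal_def, ENNReal.toReal_pos_iff]
        refine ⟨?_, measure_lt_top _ _⟩
        rw [pos_iff_ne_zero, Ne, Measure.measure_univ_eq_zero]
        exact fun h => hν (Subtype.ext h)
      exact Real.tendsto_exp_neg_atTop_nhds_zero.comp
        (tendsto_natCast_atTop_atTop.const_mul_atTop hpos)

end Superprocess

end

theorem corollary3p7 {E : Type*} [TopologicalSpace E] [MeasurableSpace E] [BorelSpace E]
    (hE : Superprocess.IsLusinSpace E)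
    {Ω : Type*} [MeasurableSpace Ω] (ξ : Superprocess.BorelRightProcess E Ω)
    (φ : Superprocess.BranchingMechanism E)
    (φstar : Superprocess.CBMechanism)
    (hbelow : ∀ (x : E) (z : ℝ), 0 ≤ z → φstar.eval z ≤ φ.localProjection x z)
    (hGrey : φstar.Grey)
    (Q : ℝ≥0 → Kernel (FiniteMeasure E) (FiniteMeasure E)) [∀ t, IsMarkovKernel (Q t)]
    (hQ : Superprocess.IsSuperprocessSemigroup ξ.P φ Q)
    (hβ : 0 < φ.betaStar) :
    ∃ C : ℝ, 0 ≤ C ∧ ∀ (t : ℝ≥0) (μ : FiniteMeasure E),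
      Superprocess.tvDist (Q t μ) (Measure.dirac (0 : FiniteMeasure E))
        ≤ C * (1 + (μ : Measure E).real univ) * Real.exp (-φ.betaStar * t) := by
  have := hE.metrizableSpace
  have := hE.secondCountableTopology
  have : MeasurableEq E := Superprocess.measurableEq_of_secondCountable_t2
  obtain ⟨D, hD0, T, hD⟩ := Superprocess.exists_uniform_decay ξ.semigroup ξ.measurable_semigroup
    hbelow hGrey hβ
  -- The `2` comes from total variation, `D` handles `t ≥ T`, and the exponential makes the bound
  -- trivial for `t ≤ T`.
  refine ⟨2 * (D + Real.exp (φ.betaStar * T)), by positivity, fun t μ => ?_⟩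
  rw [Superprocess.tvDist_dirac _ Superprocess.measurableSet_singleton_zero_finiteMeasure, neg_mul]
  set m := (μ : Measure E).real univ
  have hm0 : 0 ≤ m := measureReal_nonneg
  set e := Real.exp (-(φ.betaStar * t))
  have he : 0 < e := Real.exp_pos _
  suffices 1 - (Q t μ).real {0} ≤ (D + Real.exp (φ.betaStar * T)) * (1 + m) * e by linarith
  have hexp : 0 < Real.exp (φ.betaStar * T) := Real.exp_pos _
  have hx : 0 < Real.exp (φ.betaStar * T) * e := by positivity
  have hxm : 0 ≤ Real.exp (φ.betaStar * T) * e * m := by positivity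
  have hDe : 0 ≤ D * e := by positivity
  have hDem : 0 ≤ D * e * m := by positivity
  rcases le_total T t with hTt | htT
  · have hlow : Real.exp (-(D * e * m)) ≤ (Q t μ).real {0} := by
      refine ge_of_tendsto' (Superprocess.tendsto_laplace_const (Q t μ)) fun n => ?_
      obtain ⟨V, hV, hVQ⟩ := hQ (fun _ => (n : ℝ)) measurable_const (fun _ => n.cast_nonneg)
        ⟨n, fun _ => le_rfl⟩
      rw [hVQ t μ, Real.exp_le_exp, neg_le_neg_iff]
      exact Superprocess.integral_le_mul_measureReal _ (hV.nonneg t)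
        (hD _ V measurable_const (fun _ => n.cast_nonneg) ⟨n, fun _ => le_rfl⟩ hV t hTt)
    have := Real.add_one_le_exp (-(D * e * m))
    nlinarith
  · have h1 : 1 ≤ Real.exp (φ.betaStar * T) * e := by
      rw [← Real.exp_add]
      refine Real.one_le_exp ?_
      have : φ.betaStar * t ≤ φ.betaStar * T := mul_le_mul_of_nonneg_left htT hβ.le
      linarith
    have h2 : 0 ≤ (Q t μ).real {0} := measureReal_nonneg
    nlinarith
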